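/- Let $G$ be an infinite finitely generated group and let $H_1,\dots,H_k$ ($k\ge 0$) be a finite family of subgroups, each of infinite index in $G$. If $G$ is hyperbolic relative to $H_1,\dots,H_k$, then $G$ does not have strong Property (T) with respect to Hilbert spaces. Here the terms are used in the following sense. *Relative hyperbolicity.* For a finite generating set $S$ of $G$, the coned-off Cayley graph is obtained from the Cayley graph of $G$ with respect to $S$ (a simple graph, with edges $\{g,gs\}$ for $g\in G$, $s\in S$, $gs\ne g$) by adding, for every $i$ and every left coset $gH_i$, a vertex $\widehat{gH_i}$ joined by an edge to every element of $gH_i$. The group $G$ is hyperbolic relative to $H_1,\dots,H_k$ if for some finite generating set $S$ the coned-off Cayley graph is hyperbolic and uniformly fine. A connected graph is hyperbolic if there is $\delta>0$ such that in every geodesic triangle with vertices in the graph each side is contained in the $\delta$-neighbourhood of the union of the other two sides. A graph is uniformly fine if for every $L\ge 0$ there is $N$ such that every edge is contained in at most $N$ simple loops of length at most $L$. *Strong Property (T).* The group $G$ is equipped with the discrete topology. A length function on $G$ is a function $l:G\to[0,\infty)$ with $l(g^{-1})=l(g)$ and $l(gh)\le l(g)+l(h)$ for all $g,h\in G$. The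 group $G$ has strong Property (T) with respect to Hilbert spaces if for every length function $l$ there is a sequence $(m_n)$ of finitely supported real-valued measures on $G$ with $m_n(g^{-1})=m_n(g)$ for all $n$ and $g$, such that for every complex Hilbert space $E$ there is $t>0$ with the following property: for every representation $\pi$ of $G$ on $E$ by bounded operators such that, for some $L\ge 0$, $\|\pi(g)\|\le L e^{t\,l(g)}$ for all $g\in G$, the operators $\pi(m_n)=\sum_{g} m_n(g)\,\pi(g)$ converge in operator norm to a (not necessarily orthogonal) continuous projection of $E$ onto the subspace of $\pi(G)$-invariant vectors. -/

import Mathlib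

open Filter Topology

universe u v w

/-! ### Hyperbolic and uniformly fine graphs -/

/-- A walk is geodesic if its length is the graph distance of its endpoints. -/
def SimpleGraph.Walk.IsGeodesic {V : Type u} {X : SimpleGraph V} {x y : V} (p : X.Walk x y) :
    Prop :=
  p.length = X.dist x y

/-- A connected graph all of whose geodesic triangles are `δ`-thin: each side is contained in the
`δ`-neighbourhood of the union of the other two. Since `x`, `y`, `z` are arbitrary, it is enough to
speak about the side from `x` to `y`. -/
def SimpleGraph.IsDeltaHyperbolic {V : Type u} (X : SimpleGraph V) (δ : ℝ) : Prop :=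
  X.Connected ∧
    ∀ (x y z : V) (p : X.Walk x y) (q : X.Walk y z) (r : X.Walk x z),
      p.IsGeodesic → q.IsGeodesic → r.IsGeodesic →
        ∀ a ∈ p.support, ∃ b, (b ∈ q.support ∨ b ∈ r.support) ∧ (X.dist a b : ℝ) ≤ δ

/-- A graph is hyperbolic if it is `δ`-hyperbolic for some `δ > 0`. -/
def SimpleGraph.IsHyperbolic {V : Type u} (X : SimpleGraph V) : Prop :=
  ∃ δ : ℝ, 0 < δ ∧ X.IsDeltaHyperbolic δ

/-- A graph is uniformly fine if, for every `L`, the number of simple loops of length at most `L`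
through an edge is finite and bounded independently of the edge. Loops are taken with a base point
and an orientation, which multiplies the number of loops of length `n` by `2 * n` and hence does
not affect the existence of the bound. -/
def SimpleGraph.IsUniformlyFine {V : Type u} (X : SimpleGraph V) : Prop :=
  ∀ L : ℕ, ∃ N : ℕ, ∀ e ∈ X.edgeSet,
    {c : Σ x : V, X.Walk x x | c.2.IsCycle ∧ c.2.length ≤ L ∧ e ∈ c.2.edges}.encard ≤ N

/-! ### Relatively hyperbolic groups -/

/-- Adjacency in the coned-off Cayley graph: two elements `a ≠ b` of the group are adjacent if
they are adjacent in the Cayley graph (`b = a * s` or `a = b * s` for some `s ∈ S`), and the cone vertex of a left coset of `H i` is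
adjacent to exactly the elements of this coset. -/
def conedOffAdj {G : Type u} [Group G] {ι : Type w} (S : Set G) (H : ι → Subgroup G) :
    G ⊕ (Σ i, G ⧸ H i) → G ⊕ (Σ i, G ⧸ H i) → Prop
  | .inl a, .inl b => (SimpleGraph.mulCayley S).Adj a b
  | .inl a, .inr c => (a : G ⧸ H c.1) = c.2
  | .inr c, .inl a => (a : G ⧸ H c.1) = c.2
  | .inr _, .inr _ => False

/-- The coned-off Cayley graph of `G` with respect to `S`, relative to the family `H`: the Cayley
graph of `G` together with one cone vertex for every index `i` and every left coset of `H i`. -/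
def conedOffCayleyGraph {G : Type u} [Group G] {ι : Type w} (S : Set G) (H : ι → Subgroup G) :
    SimpleGraph (G ⊕ (Σ i, G ⧸ H i)) where
  Adj := conedOffAdj S H
  symm := ⟨by
    rintro (a | c) (b | d) h
    · exact SimpleGraph.Adj.symm h
    · exact h
    · exact h
    · exact h⟩
  loopless := ⟨by
    rintro (a | c) h
    · exact SimpleGraph.irrefl _ h
    · exact h⟩

/-- `G` is a finitely generated group hyperbolic relative to the family `H` of subgroups: for some
finite generating set, the coned-off Cayley graph is hyperbolic and uniformly fine. -/
def IsRelativelyHyperbolic {G : Type u} [Group G] {ι : Type w} (H : ι → Subgroup G) : Prop :=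
  ∃ S : Finset G, Subgroup.closure (S : Set G) = ⊤ ∧
    (conedOffCayleyGraph (S : Set G) H).IsHyperbolic ∧
    (conedOffCayleyGraph (S : Set G) H).IsUniformlyFine

/-! ### Strong Property (T) for discrete groups

Finitely generated groups carry the discrete topology. On a discrete group every function and
every representation is continuous, the compact sets are the finite ones, and a compactly
supported (signed, finite) Borel measure is a finitely supported real function. -/

/-- Length functions on a discrete group. -/
structure LengthFunction (G : Type u) [Group G] where
  /-- The length of an element. -/
  toFun : G → ℝ
  nonneg : ∀ g, 0 ≤ toFun g
  inv : ∀ g, toFun g⁻¹ = toFun g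
  mul_le : ∀ g h, toFun (g * h) ≤ toFun g + toFun h

/-- The operator `π(m) = ∫ π(g) dm(g)` for a finitely supported measure `m`. -/
noncomputable def repMeasure {G : Type u} [Group G] {E : Type v} [NormedAddCommGroup E]
    [InnerProductSpace ℂ E] (π : G →* (E →L[ℂ] E)) (m : G →₀ ℝ) : E →L[ℂ] E :=
  m.sum fun g a => (a : ℂ) • π g

/-- `P` is a (not necessarily orthogonal) continuous projection onto the subspace of
`π(G)`-invariant vectors. -/
def IsProjectionOntoInvariants {G : Type u} [Group G] {E : Type v} [NormedAddCommGroup E]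
    [InnerProductSpace ℂ E] (π : G →* (E →L[ℂ] E)) (P : E →L[ℂ] E) : Prop :=
  IsIdempotentElem P ∧ Set.range P = {ξ : E | ∀ g, π g ξ = ξ}

/-- Strong Property (T), with respect to (complex) Hilbert spaces, of a discrete group. The limit
is taken in the operator norm. -/
def HasStrongPropertyT (G : Type u) [Group G] : Prop :=
  ∀ l : LengthFunction G, ∃ m : ℕ → G →₀ ℝ, (∀ n g, m n g⁻¹ = m n g) ∧
    ∀ (E : Type v) [NormedAddCommGroup E] [InnerProductSpace ℂ E] [CompleteSpace E],
      ∃ t : ℝ, 0 < t ∧ ∀ π : G →* (E →L[ℂ] E),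
        (∃ L : ℝ, 0 ≤ L ∧ ∀ g, ‖π g‖ ≤ L * Real.exp (t * l.toFun g)) →
          ∃ P : E →L[ℂ] E, IsProjectionOntoInvariants π P ∧
            Tendsto (fun n => repMeasure π (m n)) atTop (𝓝 P)

/-! Strong Property (T) is refuted by representations `π` of arbitrarily small exponential growth
that carry a nonzero invariant functional `f` vanishing on all invariant vectors
(`HasUnsplitInvariants`). Since `f (π(m) x)` is the total mass of `m` times `f x`, the trivial
representation forces the masses to tend to 1, whereas convergence under `π` to a projection onto
the invariants forces them to tend to 0 (`not_hasStrongPropertyT`).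

The representation lives on square summable families indexed by pairs of a radius and a vertex of
the coned-off graph. Two vertices look alike from the ball of radius `k` about a base vertex `o` if
their distance functions differ by a constant there; `ρ k x` is a vertex nearest to `o` that looks
like `x`. The potential of `x` is the sum of the basis vectors at `(k, ρ k x)`, `k ≤ d(o, x)`, with
weights `exp (s * k / 2)`. The operator `T g` sends the basis vector at a node `(k, u)` to a
multiple of the difference of the potentials of `g • u` and `g • ρ (k - 1) u`. Telescoping shows
that `T g` moves the potential of `x` to that of `g • x`, whence `T g * T g' = T (g * g')`. The
functional is the coordinate at `(0, o)`, which is 1 on every potential.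

Boundedness comes from Schur's test: the matrix of `T g` has polynomially many nonzero entries, in
`d(o, g • o)`, in each row and column. The essential input is
`IsUniformlyFine.exists_encard_splitPair_le`. A geodesic from `o` determines its large angles,
called turns, however its origin is moved inside the ball. If two vertices look alike from a ball
about `o` but not from one about `o₁`, the edges leaving the turns are tied by short loops to
geodesics from `o` to `o₁` or from `o₁` to a prescribed vertex. Between turns the geodesic is
controlled by chains of short loops, of which fineness allows only boundedly many.

An invariant vector has coordinate 0 at `(0, o)` because, seen from `o`, a large ball about a remote
`g • o` has a bounded number of projections (`IsTransfer.norm_origin_le`). Remote translates exist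
because the orbits in the coned-off graph are unbounded; infinite index is used there. -/

namespace SimpleGraph

/-! ### Geodesics, and edges on a common short loop -/

section Metric

variable {V : Type*} {X : SimpleGraph V}

lemma Connected.exists_geodesic (hc : X.Connected) (x y : V) : ∃ γ : X.Walk x y, γ.IsGeodesic :=
  hc.exists_walk_length_eq_dist x y

lemma Walk.dist_getVert_le {x y : V} (γ : X.Walk x y) (i n : ℕ) (h : i + n ≤ γ.length) :
    ∃ ω : X.Walk (γ.getVert i) (γ.getVert (i + n)), ω.length = n ∧ ω.edges ⊆ γ.edges ∧
      ω.support ⊆ γ.support := by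
  induction n with
  | zero => exact ⟨Walk.nil, rfl, by simp, by simp⟩
  | succ n ih =>
    obtain ⟨ω, h1, h2, h3⟩ := ih (by omega)
    refine ⟨ω.concat (γ.adj_getVert_succ (i := i + n) (by omega)), by simp [h1], ?_, ?_⟩
    · intro e he
      rw [Walk.edges_concat, List.concat_eq_append, List.mem_append, List.mem_singleton] at he
      rcases he with he | rfl
      · exact h2 he
      · exact (γ.mk_mem_edges_iff_exists).2 ⟨i + n, by omega, rfl⟩
    · intro a ha
      rw [Walk.support_concat, List.mem_append, List.mem_singleton] at ha
      rcases ha with ha | rfl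
      · exact h3 ha
      · exact γ.getVert_mem_support _

lemma Walk.IsGeodesic.dist_getVert (hc : X.Connected) {x y : V} {γ : X.Walk x y}
    (hγ : γ.IsGeodesic) (i n : ℕ) (h : i + n ≤ γ.length) :
    X.dist (γ.getVert i) (γ.getVert (i + n)) = n := by
  have key : ∀ i n, i + n ≤ γ.length → X.dist (γ.getVert i) (γ.getVert (i + n)) ≤ n := by
    intro i n h
    obtain ⟨ω, h1, -⟩ := γ.dist_getVert_le i n h
    exact (X.dist_le ω).trans h1.le
  have h1 := key 0 i (by omega)
  have h2 := key i n h
  have h3 := key (i + n) (γ.length - (i + n)) (by omega)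
  rw [show i + n + (γ.length - (i + n)) = γ.length by omega, γ.getVert_length] at h3
  rw [zero_add, γ.getVert_zero] at h1
  have h4 := hc.dist_triangle (u := x) (v := γ.getVert i) (w := y)
  have h5 := hc.dist_triangle (u := γ.getVert i) (v := γ.getVert (i + n)) (w := y)
  unfold Walk.IsGeodesic at hγ
  omega

lemma Walk.IsGeodesic.reverse {x y : V} {γ : X.Walk x y} (hγ : γ.IsGeodesic) :
    γ.reverse.IsGeodesic := by
  unfold Walk.IsGeodesic at *
  rw [Walk.length_reverse, hγ, X.dist_comm]

lemma Walk.IsGeodesic.dist_add_dist (hc : X.Connected) {x y : V} {γ : X.Walk x y}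
    (hγ : γ.IsGeodesic) {a : V} (ha : a ∈ γ.support) :
    X.dist x a + X.dist a y = X.dist x y := by
  obtain ⟨i, rfl, hi⟩ := Walk.mem_support_iff_exists_getVert.1 ha
  have h1 := hγ.dist_getVert hc 0 i (by omega)
  have h2 := hγ.dist_getVert hc i (γ.length - i) (by omega)
  rw [show i + (γ.length - i) = γ.length by omega, γ.getVert_length] at h2
  rw [zero_add, γ.getVert_zero] at h1
  unfold Walk.IsGeodesic at hγ
  omega

/-- The subpath of a geodesic between two of its vertices. -/
lemma Walk.IsGeodesic.exists_subwalk (hc : X.Connected) {x y : V} {γ : X.Walk x y}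
    (hγ : γ.IsGeodesic) {a b : V} (ha : a ∈ γ.support) (hb : b ∈ γ.support) :
    ∃ ω : X.Walk a b, ω.length = X.dist a b ∧ ω.edges ⊆ γ.edges ∧ ω.support ⊆ γ.support := by
  obtain ⟨i, rfl, hi⟩ := Walk.mem_support_iff_exists_getVert.1 ha
  obtain ⟨j, rfl, hj⟩ := Walk.mem_support_iff_exists_getVert.1 hb
  rcases le_total i j with hij | hij
  · obtain ⟨n, rfl⟩ := Nat.exists_eq_add_of_le hij
    obtain ⟨ω, h1, h2, h3⟩ := γ.dist_getVert_le i n hj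
    exact ⟨ω, by rw [h1, hγ.dist_getVert hc i n hj], h2, h3⟩
  · obtain ⟨n, rfl⟩ := Nat.exists_eq_add_of_le hij
    obtain ⟨ω, h1, h2, h3⟩ := γ.dist_getVert_le j n hi
    refine ⟨ω.reverse, ?_, by simpa using h2, by simpa using h3⟩
    rw [Walk.length_reverse, h1, X.dist_comm, hγ.dist_getVert hc j n hi]

lemma Walk.IsGeodesic.exists_of_mem_edges (hc : X.Connected) {x y : V} {γ : X.Walk x y}
    (hγ : γ.IsGeodesic) {e : Sym2 V} (he : e ∈ γ.edges) :
    ∃ i < γ.length, e = s(γ.getVert i, γ.getVert (i + 1)) ∧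
      X.Adj (γ.getVert i) (γ.getVert (i + 1)) ∧ X.dist x (γ.getVert i) = i ∧
      X.dist x (γ.getVert (i + 1)) = i + 1 ∧
      X.dist (γ.getVert i) y + i = X.dist x y ∧
      X.dist (γ.getVert (i + 1)) y + i + 1 = X.dist x y := by
  induction e using Sym2.ind with
  | _ s t =>
    obtain ⟨i, hi, h⟩ := (γ.mk_mem_edges_iff_exists).1 he
    have h1 := hγ.dist_add_dist hc (γ.getVert_mem_support i)
    have h2 := hγ.dist_add_dist hc (γ.getVert_mem_support (i + 1))
    have h3 := hγ.dist_getVert hc 0 i (by omega)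
    have h4 := hγ.dist_getVert hc 0 (i + 1) (by omega)
    rw [zero_add, γ.getVert_zero] at h3 h4
    exact ⟨i, hi, h.symm, γ.adj_getVert_succ hi, h3, h4, by omega, by omega⟩

lemma Connected.exists_dist_eq (hc : X.Connected) (x y : V) (n : ℕ) (h : n ≤ X.dist x y) :
    ∃ a, X.dist x a = n ∧ X.dist x a + X.dist a y = X.dist x y := by
  obtain ⟨γ, hγ⟩ := hc.exists_geodesic x y
  have h3 := hγ.dist_getVert hc 0 n (by unfold Walk.IsGeodesic at hγ; omega)
  rw [zero_add, γ.getVert_zero] at h3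
  exact ⟨γ.getVert n, h3, hγ.dist_add_dist hc (γ.getVert_mem_support n)⟩

/-- The first vertex of a geodesic. -/
lemma Connected.exists_adj_dist (hc : X.Connected) {x y : V} (h : x ≠ y) :
    ∃ a, X.Adj x a ∧ X.dist a y + 1 = X.dist x y := by
  have := hc.pos_dist_of_ne h
  obtain ⟨a, h1, h2⟩ := hc.exists_dist_eq x y 1 this
  exact ⟨a, SimpleGraph.dist_eq_one_iff_adj.1 h1, by omega⟩

lemma Walk.dist_le_length_of_mem_support {x y a : V} (γ : X.Walk x y) (ha : a ∈ γ.support) :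
    X.dist x a + X.dist a y ≤ γ.length := by
  classical
  have h := congrArg Walk.length (γ.take_spec ha)
  rw [Walk.length_append] at h
  have h1 := X.dist_le (γ.takeUntil a ha)
  have h2 := X.dist_le (γ.dropUntil a ha)
  omega

/-- A walk from `x` to `y` avoiding `b`. -/
lemma Connected.exists_walk_avoiding (hc : X.Connected) {x y b : V}
    (h : X.dist x y < X.dist x b) : ∃ ω : X.Walk x y, ω.length = X.dist x y ∧ b ∉ ω.support := by
  obtain ⟨γ, hγ⟩ := hc.exists_geodesic x y
  refine ⟨γ, hγ, fun hb => ?_⟩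
  have := γ.dist_le_length_of_mem_support hb
  unfold Walk.IsGeodesic at hγ
  omega

/-- Two edges are close if they coincide or lie on a common simple loop of length at most `L`. -/
def CloseEdges (X : SimpleGraph V) (L : ℕ) (e f : Sym2 V) : Prop :=
  e = f ∨ ∃ (x : V) (c : X.Walk x x), c.IsCycle ∧ c.length ≤ L ∧ e ∈ c.edges ∧ f ∈ c.edges

lemma CloseEdges.refl (L : ℕ) (e : Sym2 V) : X.CloseEdges L e e := Or.inl rfl

lemma CloseEdges.symm {L : ℕ} {e f : Sym2 V} (h : X.CloseEdges L e f) : X.CloseEdges L f e := by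
  rcases h with rfl | ⟨x, c, h1, h2, h3, h4⟩
  · exact Or.inl rfl
  · exact Or.inr ⟨x, c, h1, h2, h4, h3⟩

lemma CloseEdges.mem_edgeSet {L : ℕ} {e f : Sym2 V} (h : X.CloseEdges L e f)
    (he : e ∈ X.edgeSet) : f ∈ X.edgeSet := by
  rcases h with rfl | ⟨x, c, h1, h2, h3, h4⟩
  · exact he
  · exact c.edges_subset_edgeSet h4

lemma dist_le_one_of_mem_edgeSet {e : Sym2 V} (he : e ∈ X.edgeSet) {x y : V}
    (hx : x ∈ e) (hy : y ∈ e) : X.dist x y ≤ 1 := by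
  induction e using Sym2.ind with
  | _ s t =>
    rw [mem_edgeSet] at he
    have h1 := SimpleGraph.dist_eq_one_iff_adj.2 he
    have h2 := SimpleGraph.dist_eq_one_iff_adj.2 he.symm
    rw [Sym2.mem_iff] at hx hy
    rcases hx with rfl | rfl <;> rcases hy with rfl | rfl <;> simp [*]

lemma CloseEdges.dist_le (hc : X.Connected) {L : ℕ} (hL : 1 ≤ L) {e f : Sym2 V}
    (h : X.CloseEdges L e f)
    (he : e ∈ X.edgeSet) {x y : V} (hx : x ∈ e) (hy : y ∈ f) : X.dist x y ≤ 2 * L := by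
  rcases h with rfl | ⟨z, c, h1, h2, h3, h4⟩
  · have := dist_le_one_of_mem_edgeSet he hx hy
    omega
  · have h5 := c.dist_le_length_of_mem_support (Walk.mem_support_of_mem_edges h3 hx)
    have h6 := c.dist_le_length_of_mem_support (Walk.mem_support_of_mem_edges h4 hy)
    have := hc.dist_triangle (u := x) (v := z) (w := y)
    omega

/-- If an edge `uv` on a geodesic from `u'` to `v'` is short-circuited by a walk `ω` whose ends
are closer to `v'` and `u'` than the edge, then the edge is close to an edge of `ω`. -/
lemma Connected.exists_closeEdges_of_detour (hc : X.Connected) {L : ℕ} {u v u' v' m n : V}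
    (huv : X.Adj u v)
    (hg : X.dist u' u + 1 + X.dist v v' = X.dist u' v') (ω : X.Walk n m)
    (hm : X.dist u' m ≤ X.dist u' u) (hn : X.dist v' n ≤ X.dist v v')
    (hL : X.dist v v' + X.dist v' n + ω.length + X.dist u' m + X.dist u' u + 1 ≤ L) :
    ∃ f ∈ ω.edges, X.CloseEdges L s(u, v) f := by
  classical
  by_cases he : s(u, v) ∈ ω.edges
  · exact ⟨_, he, CloseEdges.refl _ _⟩
  obtain ⟨w1, hw1⟩ := hc.exists_geodesic v v'
  obtain ⟨w2, hw2⟩ := hc.exists_geodesic v' n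
  obtain ⟨w3, hw3⟩ := hc.exists_geodesic m u'
  obtain ⟨w4, hw4⟩ := hc.exists_geodesic u' u
  unfold Walk.IsGeodesic at hw1 hw2 hw3 hw4
  have c1 := X.dist_comm (u := m) (v := u')
  have c2 := X.dist_comm (u := v) (v := v')
  have hS : ∀ s, X.dist v' s ≤ X.dist v v' → X.dist u' s ≤ X.dist u' u → False := by
    intro s h1 h2
    have := hc.dist_triangle (u := u') (v := s) (w := v')
    rw [X.dist_comm (u := s)] at this
    omega
  have hv : X.dist v' v ≤ X.dist v v' := c2.ge
  have m1 : ∀ s, s ∈ w1.support → X.dist v' s ≤ X.dist v v' := fun s hs => by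
    have := w1.dist_le_length_of_mem_support hs
    rw [X.dist_comm (u := s)] at this; omega
  have m2 : ∀ s, s ∈ w2.support → X.dist v' s ≤ X.dist v v' := fun s hs => by
    have := w2.dist_le_length_of_mem_support hs; omega
  have m3 : ∀ s, s ∈ w3.support → X.dist u' s ≤ X.dist u' u := fun s hs => by
    have := w3.dist_le_length_of_mem_support hs
    rw [X.dist_comm (u := s)] at this; omega
  have m4 : ∀ s, s ∈ w4.support → X.dist u' s ≤ X.dist u' u := fun s hs => by
    have := w4.dist_le_length_of_mem_support hs; omega
  set W := w1.append (w2.append (ω.append (w3.append w4))) with hW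
  have hWe : ∀ f, f ∈ W.edges → f ∈ ω.edges ∨ (∀ s ∈ f, X.dist v' s ≤ X.dist v v') ∨
      (∀ s ∈ f, X.dist u' s ≤ X.dist u' u) := by
    intro f hf
    simp only [hW, Walk.edges_append, List.mem_append] at hf
    rcases hf with hf | hf | hf | hf | hf
    · exact Or.inr (Or.inl fun s hs => m1 s (Walk.mem_support_of_mem_edges hf hs))
    · exact Or.inr (Or.inl fun s hs => m2 s (Walk.mem_support_of_mem_edges hf hs))
    · exact Or.inl hf
    · exact Or.inr (Or.inr fun s hs => m3 s (Walk.mem_support_of_mem_edges hf hs))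
    · exact Or.inr (Or.inr fun s hs => m4 s (Walk.mem_support_of_mem_edges hf hs))
  have heW : s(u, v) ∉ W.edges := by
    intro h
    rcases hWe _ h with h | h | h
    · exact he h
    · exact hS u (h u (by simp)) le_rfl
    · exact hS v hv (h v (by simp))
  have hPe : W.bypass.edges ⊆ W.edges := W.edges_bypass_subset_edges
  have hcyc : (Walk.cons huv W.bypass).IsCycle :=
    (Walk.cons_isCycle_iff _ _).2 ⟨W.bypass_isPath, fun h => heW (hPe h)⟩
  -- The simple path must leave the ball about `v'`. The first two legs stay in this ball and the
  -- last two in the disjoint ball about `u'`, so it leaves along an edge of `ω`.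
  obtain ⟨d, hd, hd1, hd2⟩ := W.bypass.exists_boundary_dart {s | X.dist v' s ≤ X.dist v v'} hv
    (fun h => hS u h le_rfl)
  have hdP : d.edge ∈ W.bypass.edges := List.mem_map_of_mem hd
  refine ⟨d.edge, ?_, Or.inr ⟨u, _, hcyc, ?_, by simp, by simp [hdP]⟩⟩
  · rcases hWe _ (hPe hdP) with h | h | h
    · exact h
    · exact absurd (h d.snd (Sym2.mem_mk_right _ _)) hd2
    · exact (hS d.fst hd1 (h d.fst (Sym2.mem_mk_left _ _))).elim
  · have := W.length_bypass_le_length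
    have hWl : W.length = w1.length + (w2.length + (ω.length + (w3.length + w4.length))) := by
      simp only [hW, Walk.length_append]
    rw [Walk.length_cons]
    omega

/-- An edge on a geodesic segment which travels along a geodesic `γ` near this edge is close to an
edge of `γ`. -/
lemma Connected.exists_closeEdges_of_fellow (hc : X.Connected) {L η : ℕ} (hL : 8 * η + 2 ≤ L)
    {u v p q p' q' : V}
    (huv : X.Adj u v) (hg : X.dist p u + 1 + X.dist v q = X.dist p q)
    {γ : X.Walk p' q'} (hγ : γ.IsGeodesic)
    (hfel : ∀ a, X.dist p a + X.dist a q = X.dist p q → X.dist u a ≤ η ∨ X.dist v a ≤ η →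
      ∃ m ∈ γ.support, X.dist a m ≤ η)
    (hp : η ≤ X.dist p u ∨ p ∈ γ.support) (hq : η ≤ X.dist v q ∨ q ∈ γ.support) :
    ∃ f ∈ γ.edges, X.CloseEdges L s(u, v) f := by
  have huv1 := SimpleGraph.dist_eq_one_iff_adj.2 huv
  -- Retreating from the edge by `η` makes the companion `m` on `γ` no farther from `a` than `u` is,
  -- as the detour lemma demands. If the geodesic ends sooner, its end already lies on `γ`.
  have hU : ∃ a, X.dist p a + X.dist a u = X.dist p u ∧ X.dist a u ≤ η ∧
      ∃ m ∈ γ.support, X.dist a m ≤ X.dist a u := by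
    by_cases h' : η ≤ X.dist p u
    · obtain ⟨a, h1, h2⟩ := hc.exists_dist_eq u p η (by rw [X.dist_comm]; exact h')
      have e1 := X.dist_comm (u := u) (v := a)
      have e2 := X.dist_comm (u := u) (v := p)
      have e3 := X.dist_comm (u := a) (v := p)
      obtain ⟨m, hm, hm'⟩ := hfel a (by
        have t1 := hc.dist_triangle (u := p) (v := a) (w := q)
        have t2 := hc.dist_triangle (u := a) (v := u) (w := q)
        have t3 := hc.dist_triangle (u := u) (v := v) (w := q)
        omega) (Or.inl h1.le)
      exact ⟨a, by omega, by omega, m, hm, by omega⟩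
    · rcases hp with h | h
      · exact absurd h h'
      · exact ⟨p, by simp, by omega, p, h, by simp⟩
  have hV : ∃ a, X.dist v a + X.dist a q = X.dist v q ∧ X.dist v a ≤ η ∧
      ∃ m ∈ γ.support, X.dist a m ≤ X.dist v a := by
    by_cases h' : η ≤ X.dist v q
    · obtain ⟨a, h1, h2⟩ := hc.exists_dist_eq v q η h'
      obtain ⟨m, hm, hm'⟩ := hfel a (by
        have t1 := hc.dist_triangle (u := p) (v := a) (w := q)
        have t2 := hc.dist_triangle (u := p) (v := v) (w := a)
        have t3 := hc.dist_triangle (u := p) (v := u) (w := v)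
        omega) (Or.inr h1.le)
      exact ⟨a, by omega, by omega, m, hm, by omega⟩
    · rcases hq with h | h
      · exact absurd h h'
      · exact ⟨q, by simp, by omega, q, h, by simp⟩
  obtain ⟨a, ha1, ha2, m, hm, ham⟩ := hU
  obtain ⟨b, hb1, hb2, n, hn, hbn⟩ := hV
  obtain ⟨ω, hω1, hω2, -⟩ := hγ.exists_subwalk hc hn hm
  have t1 := hc.dist_triangle (u := p) (v := a) (w := q)
  have t2 := hc.dist_triangle (u := a) (v := b) (w := q)
  have t3 := hc.dist_triangle (u := a) (v := u) (w := b)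
  have t4 := hc.dist_triangle (u := u) (v := v) (w := b)
  have t5 := hc.dist_triangle (u := n) (v := b) (w := m)
  have t6 := hc.dist_triangle (u := b) (v := a) (w := m)
  have e1 := X.dist_comm (u := n) (v := b)
  have e2 := X.dist_comm (u := b) (v := a)
  -- The loop has four legs of length at most `η`, the piece `ω` of length at most `4 * η + 1`, and
  -- the edge itself: `8 * η + 2` in all.
  obtain ⟨f, hf, hcl⟩ := hc.exists_closeEdges_of_detour (L := L) huv (u' := a) (v' := b)
    (by omega) ω ham hbn (by omega)
  exact ⟨f, hω2 hf, hcl⟩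

end Metric

end SimpleGraph

namespace SimpleGraph

/-! ### Thin triangles, angles at a vertex and chains of close edges -/

section Thin

variable {V : Type*} {X : SimpleGraph V}

/-- Thin triangles, with an integral constant and with points on the first side given by a
distance equality. -/
def HasThinTriangles (X : SimpleGraph V) (δ : ℕ) : Prop :=
  ∀ (x y z a : V) (q : X.Walk y z) (r : X.Walk x z), q.IsGeodesic → r.IsGeodesic →
    X.dist x a + X.dist a y = X.dist x y →
      ∃ b, (b ∈ q.support ∨ b ∈ r.support) ∧ X.dist a b ≤ δ

lemma IsDeltaHyperbolic.hasThinTriangles {δ : ℝ} (h : X.IsDeltaHyperbolic δ) :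
    X.HasThinTriangles ⌈δ⌉₊ := by
  intro x y z a q r hq hr ha
  obtain ⟨p1, hp1⟩ := h.1.exists_geodesic x a
  obtain ⟨p2, hp2⟩ := h.1.exists_geodesic a y
  obtain ⟨b, hb, hab⟩ := h.2 x y z (p1.append p2) q r
    (by unfold Walk.IsGeodesic at *; rw [Walk.length_append]; omega) hq hr a
    (by rw [Walk.mem_support_append_iff]; exact Or.inl p1.end_mem_support)
  exact ⟨b, hb, by exact_mod_cast hab.trans (Nat.le_ceil δ)⟩

lemma HasThinTriangles.exists_left {δ : ℕ} (hT : X.HasThinTriangles δ) (hc : X.Connected)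
    {x y z a : V} {γ : X.Walk y z} (hγ : γ.IsGeodesic)
    (ha : X.dist x a + X.dist a y = X.dist x y) :
    (∃ b ∈ γ.support, X.dist a b ≤ δ) ∨
      ∃ b, X.dist x b + X.dist b z = X.dist x z ∧ X.dist a b ≤ δ := by
  obtain ⟨r, hr⟩ := hc.exists_geodesic x z
  obtain ⟨b, hb | hb, hab⟩ := hT x y z a γ r hγ hr ha
  · exact Or.inl ⟨b, hb, hab⟩
  · exact Or.inr ⟨b, hr.dist_add_dist hc hb, hab⟩

lemma HasThinTriangles.exists_right {δ : ℕ} (hT : X.HasThinTriangles δ) (hc : X.Connected)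
    {x y z a : V} {γ : X.Walk x z} (hγ : γ.IsGeodesic)
    (ha : X.dist x a + X.dist a y = X.dist x y) :
    (∃ b ∈ γ.support, X.dist a b ≤ δ) ∨
      ∃ b, X.dist y b + X.dist b z = X.dist y z ∧ X.dist a b ≤ δ := by
  obtain ⟨r, hr⟩ := hc.exists_geodesic y z
  obtain ⟨b, hb | hb, hab⟩ := hT x y z a r γ hr hγ ha
  · exact Or.inr ⟨b, hr.dist_add_dist hc hb, hab⟩
  · exact Or.inl ⟨b, hb, hab⟩

lemma HasThinTriangles.exists_between {δ : ℕ} (hT : X.HasThinTriangles δ) (hc : X.Connected)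
    {x y a : V} (z : V) (ha : X.dist x a + X.dist a y = X.dist x y) :
    (∃ b, X.dist y b + X.dist b z = X.dist y z ∧ X.dist a b ≤ δ) ∨
      ∃ b, X.dist x b + X.dist b z = X.dist x z ∧ X.dist a b ≤ δ := by
  obtain ⟨q, hq⟩ := hc.exists_geodesic y z
  rcases hT.exists_left hc (z := z) hq ha with ⟨b, hb, hab⟩ | h
  · exact Or.inl ⟨b, hq.dist_add_dist hc hb, hab⟩
  · exact Or.inr h

/-- The vertex `u` at distance `δ + 1` from `b` towards `y` is within `δ` of one of the other two
sides, and a geodesic of length at most `δ` starting at `u` is too short to meet `b`. If `y` is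
nearer than that, `y` itself serves as the vertex on `γ`. -/
lemma HasThinTriangles.exists_avoiding {δ : ℕ} (hT : X.HasThinTriangles δ) (hc : X.Connected)
    {b y z b₁ b₂ : V} (h₁ : X.Adj b b₁) (hy : X.dist b₁ y + 1 = X.dist b y)
    (h₂ : X.Adj b b₂) (hz : X.dist b₂ z + 1 = X.dist b z)
    {γ : X.Walk y z} (hγ : γ.IsGeodesic) :
    (∃ ω : X.Walk b₁ b₂, ω.length ≤ 4 * δ ∧ b ∉ ω.support) ∨
      ∃ w ∈ γ.support, ∃ ω : X.Walk b₁ w, ω.length ≤ 2 * δ ∧ b ∉ ω.support := by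
  by_cases hs : X.dist b y ≤ δ + 1
  · obtain ⟨ω, h1, h2⟩ := hc.exists_walk_avoiding (x := y) (y := b₁) (b := b)
      (by rw [X.dist_comm, X.dist_comm (u := y)]; omega)
    refine Or.inr ⟨y, γ.start_mem_support, ω.reverse, ?_, by simpa using h2⟩
    rw [Walk.length_reverse, h1, X.dist_comm]
    omega
  have hb1 := SimpleGraph.dist_eq_one_iff_adj.2 h₁
  obtain ⟨u, hu1, hu2⟩ := hc.exists_dist_eq b₁ y δ (by omega)
  have t1 := hc.dist_triangle (u := b) (v := b₁) (w := u)
  have t2 := hc.dist_triangle (u := b) (v := u) (w := y)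
  have c1 := X.dist_comm (u := b) (v := u)
  have c2 := X.dist_comm (u := b₁) (v := u)
  obtain ⟨ω₁, hω₁, hbω₁⟩ := hc.exists_walk_avoiding (x := u) (y := b₁) (b := b) (by omega)
  obtain ⟨r, hr⟩ := hc.exists_geodesic b₂ z
  have hr' : (Walk.cons h₂ r).IsGeodesic := by
    unfold Walk.IsGeodesic at *
    rw [Walk.length_cons]
    omega
  obtain ⟨w, hw | hw, huw⟩ := hT b y z u γ (Walk.cons h₂ r) hγ hr' (by omega)
  · obtain ⟨ω₂, hω₂, hbω₂⟩ := hc.exists_walk_avoiding (x := u) (y := w) (b := b) (by omega)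
    refine Or.inr ⟨w, hw, ω₁.reverse.append ω₂, ?_, ?_⟩
    · rw [Walk.length_append, Walk.length_reverse]; omega
    · simp [Walk.mem_support_append_iff, hbω₁, hbω₂]
  · rw [Walk.support_cons, List.mem_cons] at hw
    rcases hw with rfl | hw
    · omega
    have t3 := hr.dist_add_dist hc hw
    have t4 := hc.dist_triangle (u := b) (v := w) (w := z)
    have t5 := hc.dist_triangle (u := b) (v := u) (w := w)
    have t6 := hc.dist_triangle (u := b) (v := b₂) (w := w)
    have hb2 := SimpleGraph.dist_eq_one_iff_adj.2 h₂
    have c3 := X.dist_comm (u := b) (v := w)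
    have c4 := X.dist_comm (u := b₂) (v := w)
    obtain ⟨ω₂, hω₂, hbω₂⟩ := hc.exists_walk_avoiding (x := u) (y := w) (b := b) (by omega)
    obtain ⟨ω₃, hω₃, hbω₃⟩ := hc.exists_walk_avoiding (x := w) (y := b₂) (b := b) (by omega)
    refine Or.inl ⟨ω₁.reverse.append (ω₂.append ω₃), ?_, ?_⟩
    · simp only [Walk.length_append, Walk.length_reverse]; omega
    · simp [Walk.mem_support_append_iff, hbω₁, hbω₂, hbω₃]

lemma closeEdges_of_avoiding {L : ℕ} {b b₁ b₂ : V} (h₁ : X.Adj b b₁) (h₂ : X.Adj b b₂)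
    (ω : X.Walk b₁ b₂) (hω : ω.length + 2 ≤ L) (hb : b ∉ ω.support) :
    X.CloseEdges L s(b, b₁) s(b, b₂) := by
  classical
  by_cases h12 : b₁ = b₂
  · subst h12; exact CloseEdges.refl _ _
  have hbP : b ∉ ω.bypass.support := fun h => hb (ω.support_bypass_subset_support h)
  have hP : (ω.bypass.concat h₂.symm).IsPath := ω.bypass_isPath.concat hbP h₂.symm
  refine Or.inr ⟨b, Walk.cons h₁ (ω.bypass.concat h₂.symm),
    (Walk.cons_isCycle_iff _ _).2 ⟨hP, ?_⟩, ?_, by simp, ?_⟩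
  · rw [Walk.edges_concat, List.concat_eq_append, List.mem_append, List.mem_singleton]
    rintro (h | h)
    · exact hbP (Walk.fst_mem_support_of_mem_edges _ h)
    · rw [Sym2.eq_swap, Sym2.congr_left] at h
      exact h12 h
  · have := ω.length_bypass_le_length
    rw [Walk.length_cons, Walk.length_concat]
    omega
  · simp [Walk.edges_concat, Sym2.eq_swap]

/-- Two geodesics issuing from `b` whose first edges are not close concatenate to a geodesic. -/
lemma HasThinTriangles.closeEdges_of_dist_ne {δ L : ℕ} (hT : X.HasThinTriangles δ)
    (hc : X.Connected) (hL : 8 * δ + 4 ≤ L)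
    {b y z b₁ b₂ : V} (h₁ : X.Adj b b₁) (hy : X.dist b₁ y + 1 = X.dist b y)
    (h₂ : X.Adj b b₂) (hz : X.dist b₂ z + 1 = X.dist b z)
    (hne : X.dist y b + X.dist b z ≠ X.dist y z) :
    X.CloseEdges L s(b, b₁) s(b, b₂) := by
  obtain ⟨γ, hγ⟩ := hc.exists_geodesic y z
  have hbγ : b ∉ γ.support := fun h => hne (hγ.dist_add_dist hc h)
  rcases hT.exists_avoiding hc h₁ hy h₂ hz hγ with ⟨ω, h1, h2⟩ | ⟨w, hw, ω, h1, h2⟩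
  · exact closeEdges_of_avoiding h₁ h₂ ω (by omega) h2
  rcases hT.exists_avoiding hc h₂ hz h₁ hy hγ.reverse with ⟨ω', h1', h2'⟩ | ⟨w', hw', ω', h1', h2'⟩
  · exact (closeEdges_of_avoiding h₂ h₁ ω' (by omega) h2').symm
  -- Both first vertices reach `γ` within `2 * δ`, so the part of `γ` between the two landing points
  -- has length at most `4 * δ + 2`. It misses `b`, and with the two edges at `b` the loop has
  -- length at most `8 * δ + 4`.
  obtain ⟨ρ, hρ, -, hρ'⟩ := hγ.exists_subwalk hc hw (by simpa using hw')
  have d1 := X.dist_le (ω.reverse.append (Walk.cons h₁.symm (Walk.cons h₂ ω')))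
  simp only [Walk.length_append, Walk.length_reverse, Walk.length_cons] at d1
  refine closeEdges_of_avoiding h₁ h₂ (ω.append (ρ.append ω'.reverse)) ?_ ?_
  · simp only [Walk.length_append, Walk.length_reverse]
    omega
  · simp only [Walk.mem_support_append_iff, Walk.support_reverse, List.mem_reverse, not_or]
    exact ⟨h2, fun h => hbγ (hρ' h), h2'⟩

/-- Edges joined by a chain of `n` steps between close edges. -/
def ChainEdges (X : SimpleGraph V) (L : ℕ) : ℕ → Sym2 V → Sym2 V → Prop
  | 0, e, f => e = f
  | n + 1, e, f => ∃ e', ChainEdges X L n e e' ∧ X.CloseEdges L e' f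

lemma CloseEdges.chain {L : ℕ} {e f : Sym2 V} (h : X.CloseEdges L e f) : X.ChainEdges L 1 e f :=
  ⟨e, rfl, h⟩

lemma ChainEdges.trans {L m n : ℕ} {e f g : Sym2 V} (h : X.ChainEdges L m e f)
    (h' : X.ChainEdges L n f g) : X.ChainEdges L (m + n) e g := by
  induction n generalizing g with
  | zero => obtain rfl : f = g := h'; exact h
  | succ n ih =>
    obtain ⟨e', h1, h2⟩ := h'
    exact ⟨e', ih h1, h2⟩

lemma ChainEdges.mono {L m n : ℕ} (hmn : m ≤ n) {e f : Sym2 V} (h : X.ChainEdges L m e f) :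
    X.ChainEdges L n e f := by
  induction hmn with
  | refl => exact h
  | step _ ih => exact ⟨f, ih, CloseEdges.refl _ _⟩

lemma ChainEdges.symm {L n : ℕ} {e f : Sym2 V} (h : X.ChainEdges L n e f) :
    X.ChainEdges L n f e := by
  induction n generalizing f with
  | zero => exact Eq.symm h
  | succ n ih =>
    obtain ⟨e', h1, h2⟩ := h
    exact (h2.symm.chain.trans (ih h1)).mono (by omega)

lemma ChainEdges.mem_edgeSet {L n : ℕ} {e f : Sym2 V} (h : X.ChainEdges L n e f)
    (he : e ∈ X.edgeSet) : f ∈ X.edgeSet := by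
  induction n generalizing f with
  | zero => obtain rfl : e = f := h; exact he
  | succ n ih =>
    obtain ⟨e', h1, h2⟩ := h
    exact h2.mem_edgeSet (ih h1)

lemma ChainEdges.dist_le (hc : X.Connected) {L n : ℕ} (hL : 1 ≤ L) {e f : Sym2 V}
    (h : X.ChainEdges L n e f) (he : e ∈ X.edgeSet) {x y : V} (hx : x ∈ e) (hy : y ∈ f) :
    X.dist x y ≤ 2 * L * n + 1 := by
  induction n generalizing f y with
  | zero =>
    obtain rfl : e = f := h
    simpa using dist_le_one_of_mem_edgeSet he hx hy
  | succ n ih =>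
    obtain ⟨e', h1, h2⟩ := h
    obtain ⟨z, hz⟩ : ∃ z, z ∈ e' := by
      induction e' using Sym2.ind with
      | _ s t => exact ⟨s, Sym2.mem_mk_left _ _⟩
    have h3 := ih h1 hz
    have h4 := h2.dist_le hc hL (h1.mem_edgeSet he) hz hy
    have := hc.dist_triangle (u := x) (v := z) (w := y)
    rw [Nat.mul_succ]
    omega

lemma IsUniformlyFine.exists_encard_closeEdges_le (hf : X.IsUniformlyFine) (L : ℕ) :
    ∃ N : ℕ, ∀ e ∈ X.edgeSet, {f | X.CloseEdges L e f}.encard ≤ N := by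
  obtain ⟨N, hN⟩ := hf L
  refine ⟨1 + N * L, fun e he => ?_⟩
  set S := {c : Σ x : V, X.Walk x x | c.2.IsCycle ∧ c.2.length ≤ L ∧ e ∈ c.2.edges} with hS
  have hSN : S.encard ≤ N := hN e he
  have hfin : S.Finite := Set.finite_of_encard_le_coe hSN
  classical
  have hsub : {f | X.CloseEdges L e f} ⊆
      ({e} ∪ hfin.toFinset.biUnion fun c => c.2.edges.toFinset : Finset (Sym2 V)) := by
    rintro f (rfl | ⟨x, c, h1, h2, h3, h4⟩)
    · simp
    · simp only [Finset.coe_union, Finset.coe_singleton, Set.mem_union, Finset.mem_coe,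
        Finset.mem_biUnion, Set.Finite.mem_toFinset, List.mem_toFinset]
      exact Or.inr ⟨⟨x, c⟩, ⟨h1, h2, h3⟩, h4⟩
  refine (Set.encard_le_encard hsub).trans ?_
  rw [Set.encard_coe_eq_coe_finsetCard]
  have h1 : (hfin.toFinset.biUnion fun c => c.2.edges.toFinset).card ≤ hfin.toFinset.card * L := by
    refine Finset.card_biUnion_le_card_mul _ _ _ fun c hc => ?_
    rw [Set.Finite.mem_toFinset] at hc
    refine (List.toFinset_card_le _).trans ?_
    rw [Walk.length_edges]
    exact hc.2.1
  have h2 : hfin.toFinset.card ≤ N := by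
    rw [hfin.encard_eq_coe_toFinset_card] at hSN
    exact_mod_cast hSN
  have h3 := Finset.card_union_le {e} (hfin.toFinset.biUnion fun c => c.2.edges.toFinset)
  rw [Finset.card_singleton] at h3
  have h4 := Nat.mul_le_mul_right L h2
  exact_mod_cast h3.trans (by omega)

/-- The ends of the edges reached from `e` by chains of length `n`. -/
def chainEnds (X : SimpleGraph V) (L n : ℕ) (e : Sym2 V) : Set V :=
  {x | ∃ f, X.ChainEdges L n e f ∧ x ∈ f}

lemma chainEnds_finite_of_card {L n N : ℕ} {e : Sym2 V}
    (h : {f | X.ChainEdges L n e f}.encard ≤ N) : (X.chainEnds L n e).encard ≤ 2 * N := by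
  classical
  have hfin := Set.finite_of_encard_le_coe h
  have hsub : X.chainEnds L n e ⊆ (hfin.toFinset.biUnion fun f => f.toFinset : Finset V) := by
    rintro x ⟨f, hf, hx⟩
    simp only [Finset.coe_biUnion, Set.mem_iUnion, Finset.mem_coe, Set.Finite.mem_toFinset]
    exact ⟨f, hf, by simpa using hx⟩
  refine (Set.encard_le_encard hsub).trans ?_
  rw [Set.encard_coe_eq_coe_finsetCard]
  have h1 : (hfin.toFinset.biUnion fun f => f.toFinset).card ≤ hfin.toFinset.card * 2 := by
    refine Finset.card_biUnion_le_card_mul _ _ _ fun f _ => ?_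
    rw [Sym2.card_toFinset]
    split_ifs <;> omega
  have h2 : hfin.toFinset.card ≤ N := by
    rw [hfin.encard_eq_coe_toFinset_card] at h
    exact_mod_cast h
  exact_mod_cast h1.trans (by omega)

lemma IsUniformlyFine.exists_encard_chainEdges_le (hf : X.IsUniformlyFine) (L n : ℕ) :
    ∃ N : ℕ, ∀ e ∈ X.edgeSet, {f | X.ChainEdges L n e f}.encard ≤ N := by
  obtain ⟨N, hN⟩ := hf.exists_encard_closeEdges_le L
  induction n with
  | zero =>
    refine ⟨1, fun e he => ?_⟩
    simp [ChainEdges]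
  | succ n ih =>
    obtain ⟨M, hM⟩ := ih
    refine ⟨M * N, fun e he => ?_⟩
    classical
    have hfin := Set.finite_of_encard_le_coe (hM e he)
    have hfin2 : ∀ f : Sym2 V, X.ChainEdges L n e f → {g | X.CloseEdges L f g}.Finite :=
      fun f hf => Set.finite_of_encard_le_coe (hN f (hf.mem_edgeSet he))
    let F : Sym2 V → Finset (Sym2 V) := fun f =>
      if h : X.ChainEdges L n e f then (hfin2 f h).toFinset else ∅
    have hsub : {f | X.ChainEdges L (n + 1) e f} ⊆ (hfin.toFinset.biUnion F : Finset (Sym2 V)) := by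
      rintro g ⟨f, h1, h2⟩
      simp only [Finset.coe_biUnion, Set.mem_iUnion, Finset.mem_coe, Set.Finite.mem_toFinset]
      exact ⟨f, h1, by simp only [F, dif_pos h1, Set.Finite.mem_toFinset]; exact h2⟩
    refine (Set.encard_le_encard hsub).trans ?_
    rw [Set.encard_coe_eq_coe_finsetCard]
    have h1 : (hfin.toFinset.biUnion F).card ≤ hfin.toFinset.card * N := by
      refine Finset.card_biUnion_le_card_mul _ _ _ fun f hf => ?_
      rw [Set.Finite.mem_toFinset] at hf
      have hf' : X.ChainEdges L n e f := hf
      simp only [F, dif_pos hf']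
      have := hN f (hf'.mem_edgeSet he)
      rw [(hfin2 f hf').encard_eq_coe_toFinset_card] at this
      exact_mod_cast this
    have h2 : hfin.toFinset.card ≤ M := by
      have := hM e he
      rw [hfin.encard_eq_coe_toFinset_card] at this
      exact_mod_cast this
    exact_mod_cast h1.trans (Nat.mul_le_mul_right N h2)

lemma IsUniformlyFine.exists_encard_chainEnds_le (hf : X.IsUniformlyFine) (L n : ℕ) :
    ∃ N : ℕ, ∀ e ∈ X.edgeSet, (X.chainEnds L n e).encard ≤ N := by
  obtain ⟨N, hN⟩ := hf.exists_encard_chainEdges_le L n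
  exact ⟨2 * N, fun e he => by exact_mod_cast chainEnds_finite_of_card (hN e he)⟩

end Thin

end SimpleGraph

namespace SimpleGraph

/-! ### Views from balls, turns of geodesics and the count of split pairs -/

section View

variable {V : Type*} {X : SimpleGraph V}

/-- Two vertices look alike from the ball of radius `k` about `o` if their distance functions
differ by a constant on this ball. -/
def SameView (X : SimpleGraph V) (o : V) (k : ℕ) (x y : V) : Prop :=
  ∀ z, X.dist o z ≤ k → X.dist x z + X.dist y o = X.dist y z + X.dist x o

lemma SameView.refl (o : V) (k : ℕ) (x : V) : X.SameView o k x x := fun _ _ => rfl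

lemma SameView.symm {o : V} {k : ℕ} {x y : V} (h : X.SameView o k x y) : X.SameView o k y x :=
  fun z hz => (h z hz).symm

lemma SameView.trans {o : V} {k : ℕ} {x y z : V} (h : X.SameView o k x y)
    (h' : X.SameView o k y z) : X.SameView o k x z := by
  intro a ha
  have h1 := h a ha
  have h2 := h' a ha
  omega

lemma SameView.mono {o : V} {k l : ℕ} (hkl : k ≤ l) {x y : V} (h : X.SameView o l x y) :
    X.SameView o k x y := fun z hz => h z (hz.trans hkl)

lemma SameView.of_dist_add_le (hc : X.Connected) {o o₁ : V} {k l : ℕ} {x y : V}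
    (h : X.SameView o l x y) (hkl : k + X.dist o o₁ ≤ l) : X.SameView o₁ k x y := by
  intro z hz
  have h1 := hc.dist_triangle (u := o) (v := o₁) (w := z)
  have h2 := h z (by omega)
  have h3 := h o₁ (by omega)
  omega

lemma sameView_zero (hc : X.Connected) (o x y : V) : X.SameView o 0 x y := by
  intro z hz
  obtain rfl : o = z := hc.dist_eq_zero_iff.1 (by omega)
  omega

lemma SameView.dist_eq {o : V} {k : ℕ} {x y : V} (h : X.SameView o k x y)
    (hx : X.dist o x ≤ k) : X.dist o y = X.dist o x + X.dist x y := by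
  have h1 := h x hx
  have h2 := X.dist_self (v := x)
  have h3 := X.dist_comm (u := o) (v := x)
  have h4 := X.dist_comm (u := o) (v := y)
  have h5 := X.dist_comm (u := x) (v := y)
  omega

/-- A neighbour of `x` one step towards `y` would still lie in the ball; moving to it raises the
distance to `x` but lowers the distance to `y`. -/
lemma SameView.eq_of_dist_lt (hc : X.Connected) {o : V} {k : ℕ} {x y : V}
    (h : X.SameView o k x y) (hx : X.dist o x < k) : x = y := by
  by_contra hne
  obtain ⟨w, hw1, hw2⟩ := hc.exists_adj_dist hne
  have h1 := h.dist_eq hx.le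
  have h2 := SimpleGraph.dist_eq_one_iff_adj.2 hw1
  have h3 := hc.dist_triangle (u := o) (v := x) (w := w)
  have h4 := h w (by omega)
  have h5 := X.dist_comm (u := o) (v := x)
  have h6 := X.dist_comm (u := o) (v := y)
  have h7 := X.dist_comm (u := y) (v := w)
  omega

lemma SameView.between {o : V} {k : ℕ} {x y a : V} (h : X.SameView o k x y)
    (ha : X.dist o a ≤ k) (hax : X.dist o a + X.dist a x = X.dist o x) :
    X.dist o a + X.dist a y = X.dist o y := by
  have h1 := h a ha
  have h3 := X.dist_comm (u := o) (v := x)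
  have h4 := X.dist_comm (u := o) (v := y)
  have h5 := X.dist_comm (u := x) (v := a)
  have h6 := X.dist_comm (u := y) (v := a)
  omega

/-- If the distance functions to `x` and to `y` differ by a constant on a set `W` which separates
both of them from `z`, then they differ by the same constant at `z`. -/
lemma Connected.dist_add_of_gate (hc : X.Connected) {W : Set V} {x y z w₀ : V} (hw₀ : w₀ ∈ W)
    (hW : ∀ w ∈ W, ∀ w' ∈ W, X.dist x w + X.dist y w' = X.dist x w' + X.dist y w)
    (hx : ∃ w ∈ W, X.dist x w + X.dist w z = X.dist x z)
    (hy : ∃ w ∈ W, X.dist y w + X.dist w z = X.dist y z) :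
    X.dist x z + X.dist y w₀ = X.dist y z + X.dist x w₀ := by
  obtain ⟨w, hw, hxw⟩ := hx
  obtain ⟨w', hw', hyw⟩ := hy
  have h1 := hW w hw w₀ hw₀
  have h2 := hW w' hw' w₀ hw₀
  have h3 := hc.dist_triangle (u := x) (v := w') (w := z)
  have h4 := hc.dist_triangle (u := y) (v := w) (w := z)
  omega

/-- `x` is nearest to `o` among the vertices which look alike from the ball of radius `k`. -/
def IsNearest (X : SimpleGraph V) (o : V) (k : ℕ) (x : V) : Prop :=
  ∀ y, X.SameView o k x y → X.dist o x ≤ X.dist o y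

/-- An oriented edge on a geodesic from `p` to `q`. -/
def Traverses (X : SimpleGraph V) (p s t q : V) : Prop :=
  X.Adj s t ∧ X.dist p s + 1 + X.dist t q = X.dist p q

lemma Traverses.dist_fst (hc : X.Connected) {p s t q : V} (h : X.Traverses p s t q) :
    X.dist p s + X.dist s q = X.dist p q ∧ X.dist p t = X.dist p s + 1 := by
  obtain ⟨h1, h2⟩ := h
  have h3 := SimpleGraph.dist_eq_one_iff_adj.2 h1
  have t1 := hc.dist_triangle (u := p) (v := s) (w := t)
  have t2 := hc.dist_triangle (u := s) (v := t) (w := q)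
  have t3 := hc.dist_triangle (u := p) (v := t) (w := q)
  have t4 := hc.dist_triangle (u := p) (v := s) (w := q)
  omega

lemma Walk.IsGeodesic.exists_traverses (hc : X.Connected) {x y p q : V} {γ : X.Walk x y}
    (hγ : γ.IsGeodesic) (h : X.dist p x + X.dist x y + X.dist y q = X.dist p q)
    {e : Sym2 V} (he : e ∈ γ.edges) :
    ∃ s t, e = s(s, t) ∧ X.Traverses p s t q ∧ X.dist p s + X.dist s y = X.dist p y ∧
      X.dist p t + X.dist t y = X.dist p y := by
  obtain ⟨i, hi, rfl, h1, h2, h3, h4, h5⟩ := hγ.exists_of_mem_edges hc he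
  have t1 := hc.dist_triangle (u := p) (v := x) (w := γ.getVert i)
  have t2 := hc.dist_triangle (u := γ.getVert (i + 1)) (v := y) (w := q)
  have t3 := hc.dist_triangle (u := p) (v := γ.getVert i) (w := q)
  have t4 := hc.dist_triangle (u := γ.getVert i) (v := γ.getVert (i + 1)) (w := q)
  have t5 := SimpleGraph.dist_eq_one_iff_adj.2 h1
  have t6 := hc.dist_triangle (u := p) (v := x) (w := y)
  have t7 := hc.dist_triangle (u := p) (v := y) (w := q)
  have t8 := hc.dist_triangle (u := p) (v := γ.getVert i) (w := y)
  have t9 := hc.dist_triangle (u := p) (v := γ.getVert (i + 1)) (w := y)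
  have t10 := hc.dist_triangle (u := p) (v := γ.getVert i) (w := γ.getVert (i + 1))
  exact ⟨_, _, rfl, ⟨h1, by omega⟩, by omega, by omega⟩

/-- A turn of a path from `o` is its origin or a vertex where the incoming and the outgoing edge
are not joined by a chain of three steps between close edges. -/
def Walk.IsTurn (L : ℕ) {o x : V} (γ : X.Walk o x) (i : ℕ) : Prop :=
  i = 0 ∨ ¬ X.ChainEdges L 3 s(γ.getVert (i - 1), γ.getVert i) s(γ.getVert i, γ.getVert (i + 1))

lemma Walk.IsGeodesic.dist_getVert_right (hc : X.Connected) {o x : V} {γ : X.Walk o x}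
    (hγ : γ.IsGeodesic) {i : ℕ} (hi : i ≤ γ.length) :
    X.dist o (γ.getVert i) = i ∧ X.dist (γ.getVert i) x + i = X.dist o x := by
  have h1 := hγ.dist_getVert hc 0 i (by omega)
  have h2 := hγ.dist_add_dist hc (γ.getVert_mem_support i)
  rw [zero_add, γ.getVert_zero] at h1
  omega

/-- At a turn `b` of a geodesic from `o`, a geodesic from `b` to `z` whose first edge is joined by
a chain of two steps to the outgoing edge extends the incoming geodesic. -/
lemma HasThinTriangles.dist_add_of_isTurn {δ L : ℕ} (hT : X.HasThinTriangles δ)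
    (hc : X.Connected) (hL : 8 * δ + 4 ≤ L) {o x : V} {γ : X.Walk o x} (hγ : γ.IsGeodesic)
    {i : ℕ} (hi : i < γ.length) (ht : γ.IsTurn L i) {z b' : V} (hb' : X.Adj (γ.getVert i) b')
    (hz : X.dist b' z + 1 = X.dist (γ.getVert i) z)
    (hch : X.ChainEdges L 2 s(γ.getVert i, γ.getVert (i + 1)) s(γ.getVert i, b')) :
    X.dist o (γ.getVert i) + X.dist (γ.getVert i) z = X.dist o z := by
  by_contra hne
  rcases ht with rfl | ht
  · exact hne (by simp)
  rcases Nat.eq_zero_or_pos i with rfl | hpos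
  · exact hne (by simp)
  obtain ⟨j, rfl⟩ : ∃ j, i = j + 1 := ⟨i - 1, by omega⟩
  rw [Nat.add_sub_cancel] at ht
  have h1 := (hγ.dist_getVert_right hc (i := j) (by omega)).1
  have h2 := (hγ.dist_getVert_right hc (i := j + 1) (by omega)).1
  -- A failure to extend geodesically makes the incoming edge close to the edge towards `b'`. This
  -- one step and the two of `hch` are the three steps excluded at a turn.
  have h3 := hT.closeEdges_of_dist_ne hc hL (γ.adj_getVert_succ (i := j) (by omega)).symm
    (y := o) (by rw [X.dist_comm, h1, X.dist_comm, h2]) hb' hz hne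
  rw [Sym2.eq_swap] at h3
  exact ht (h3.chain.trans hch.symm)

/-- A geodesic passes through its turns however its initial point is moved in the ball. -/
lemma HasThinTriangles.sameView_of_isTurn {δ L : ℕ} (hT : X.HasThinTriangles δ)
    (hc : X.Connected) (hL : 8 * δ + 4 ≤ L) {o x : V} {γ : X.Walk o x} (hγ : γ.IsGeodesic)
    {i : ℕ} (hi : i < γ.length) (ht : γ.IsTurn L i) : X.SameView o i x (γ.getVert i) := by
  obtain ⟨g1, g2⟩ := hγ.dist_getVert_right hc hi.le
  have g3 := (hγ.dist_getVert_right hc (i := i + 1) hi).2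
  -- If the turn were not between `x` and `z`, the first edge towards `z` would be close to the
  -- outgoing edge. By the preceding lemma `z` would then lie beyond the turn as seen from `o`,
  -- outside the ball.
  have key : ∀ z, X.dist o z ≤ i →
      X.dist x (γ.getVert i) + X.dist (γ.getVert i) z = X.dist x z := by
    intro z hz
    by_cases hbz : γ.getVert i = z
    · subst hbz; simp
    by_contra hne
    obtain ⟨b', hb1, hb2⟩ := hc.exists_adj_dist hbz
    have h1 := hT.closeEdges_of_dist_ne hc hL (γ.adj_getVert_succ hi) (by omega) hb1 hb2 hne
    have h2 := hT.dist_add_of_isTurn hc hL hγ hi ht hb1 hb2 (h1.chain.mono (by omega))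
    have := hc.pos_dist_of_ne hbz
    omega
  intro z hz
  have h1 := key z hz
  have h2 := X.dist_comm (u := o) (v := x)
  have h3 := X.dist_comm (u := γ.getVert i) (v := o)
  have h4 := X.dist_comm (u := γ.getVert i) (v := x)
  omega

/-- A turn at height at least `k` looks like `x` from the ball of radius `k` and is nearer to `o`
than `x`. -/
lemma IsNearest.lt_of_isTurn {δ L : ℕ} (hT : X.HasThinTriangles δ)
    (hc : X.Connected) (hL : 8 * δ + 4 ≤ L) {o x : V} {k : ℕ} (hx : X.IsNearest o k x)
    {γ : X.Walk o x} (hγ : γ.IsGeodesic)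
    {i : ℕ} (hi : i < γ.length) (ht : γ.IsTurn L i) : i < k := by
  by_contra hk
  have h1 := hx _ ((hT.sameView_of_isTurn hc hL hγ hi ht).mono (not_lt.1 hk))
  have h2 := (hγ.dist_getVert_right hc hi.le).1
  unfold Walk.IsGeodesic at hγ
  omega

/-- The data of the comparison of two base points `o` and `o₁`: nearest vertices `x` and `y` for
the radii `k` and `k - 1` about `o` which look alike from the smaller ball, but not from the ball
of radius `R` about `o₁`, and a vertex `p ∈ {x, y}` which looks like `c` from the latter ball. -/
structure SplitPair (X : SimpleGraph V) (o o₁ : V) (k R : ℕ) (c x y p : V) : Prop where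
  pos : 1 ≤ k
  le_dist : k ≤ X.dist o x
  nearest : X.IsNearest o k x
  nearest' : X.IsNearest o (k - 1) y
  same : X.SameView o (k - 1) x y
  not_same : ¬ X.SameView o₁ R x y
  eq_or : p = x ∨ p = y
  same_c : X.SameView o₁ R p c
  le_dist_p : R ≤ X.dist o₁ p

/-- An edge joined by a chain of two steps to an edge of a geodesic from `o` to `o₁` or from `o₁`
to `c`. -/
def IsAnchored (X : SimpleGraph V) (L : ℕ) (o o₁ c : V) (e : Sym2 V) : Prop :=
  ∃ s t, (X.Traverses o s t o₁ ∨ X.Traverses o₁ s t c) ∧ X.ChainEdges L 2 s(s, t) e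

/-- Let `ba` be the edge leaving the turn `b`. It also starts a geodesic from `b` to `y`, unless `y
= b`. If `b` lay between both of `x`, `y` and every vertex of the ball about `o₁`, then `x` and `y`
would look alike from it. So some `z` in this ball is reached from `b` through an edge close to
`ba`, and the position of `o₁` decides which of the two geodesics anchors `ba`. -/
lemma SplitPair.isAnchored_of_isTurn {δ L : ℕ} (hT : X.HasThinTriangles δ)
    (hc : X.Connected) (hL : 8 * δ + 4 ≤ L) {o o₁ : V} {k R : ℕ} {c x y p : V}
    (h : X.SplitPair o o₁ k R c x y p) {γ : X.Walk o x} (hγ : γ.IsGeodesic)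
    {i : ℕ} (hi : i < γ.length) (ht : γ.IsTurn L i) :
    X.IsAnchored L o o₁ c s(γ.getVert i, γ.getVert (i + 1)) := by
  have hik := h.nearest.lt_of_isTurn hT hc hL hγ hi ht
  obtain ⟨g1, g2⟩ := hγ.dist_getVert_right hc hi.le
  obtain ⟨g3, g4⟩ := hγ.dist_getVert_right hc (i := i + 1) hi
  have hadj := γ.adj_getVert_succ hi
  have hsame := hT.sameView_of_isTurn hc hL hγ hi ht
  have hturn := fun z b' => hT.dist_add_of_isTurn hc hL hγ hi ht (z := z) (b' := b')
  set b := γ.getVert i with hb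
  set a := γ.getVert (i + 1) with ha
  clear_value a b
  have cab := SimpleGraph.dist_eq_one_iff_adj.2 hadj
  -- either `y = b`, or the geodesics from `b` to `x` and to `y` may start with the edge `ba`
  have hy : y = b ∨ X.dist a y + 1 = X.dist b y := by
    rcases Nat.lt_or_ge (i + 1) k with hk | hk
    · right
      have h1 := h.same.between (a := b) (by omega) (by omega)
      have h2 := h.same.between (a := a) (by omega) (by omega)
      omega
    · left
      obtain rfl : i = k - 1 := by omega
      have h1 := h.same.symm.trans hsame
      have h2 := h.nearest' _ h1
      have h3 := h1.symm.dist_eq (by omega)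
      exact (hc.dist_eq_zero_iff.1 (by omega)).symm
  have hx : X.dist a x + 1 = X.dist b x := by omega
  have hq : ∀ q, q = x ∨ q = y → q = b ∨ X.dist a q + 1 = X.dist b q := by
    rintro q (rfl | rfl)
    · exact Or.inr hx
    · exact hy
  have hang : ∀ q, q = x ∨ q = y → ∀ z b', X.Adj b b' → X.dist b' z + 1 = X.dist b z →
      X.dist q b + X.dist b z ≠ X.dist q z → X.CloseEdges L s(b, a) s(b, b') := by
    intro q hq' z b' h1 h2 hne
    rcases hq q hq' with rfl | h3
    · exact absurd (by simp) hne
    · exact hT.closeEdges_of_dist_ne hc hL hadj h3 h1 h2 hne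
  obtain ⟨z, hzR, q, hq', hz⟩ : ∃ z, X.dist o₁ z ≤ R ∧ ∃ q, (q = x ∨ q = y) ∧
      X.dist q b + X.dist b z ≠ X.dist q z := by
    by_contra hcon
    push Not at hcon
    refine h.not_same fun z hz => ?_
    have h1 := hcon z hz x (Or.inl rfl)
    have h2 := hcon z hz y (Or.inr rfl)
    have h3 := hcon o₁ (by simp) x (Or.inl rfl)
    have h4 := hcon o₁ (by simp) y (Or.inr rfl)
    omega
  have hbz : b ≠ z := by rintro rfl; exact hz (by simp)
  obtain ⟨b', hb1, hb2⟩ := hc.exists_adj_dist hbz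
  have hcl := hang q hq' z b' hb1 hb2 hz
  -- If an edge towards `o₁` is within two steps of `ba`, the turn puts it on a geodesic from `o` to
  -- `o₁`. Otherwise `b` lies between `o₁` and both `p` and `z`, so `d(o₁, b) < R`. The edge `ba`
  -- towards `p` then ends inside the ball from which `p` looks like `c`, and hence lies on a
  -- geodesic from `o₁` to `c`.
  by_cases hA : ∃ b₁, X.Adj b b₁ ∧ X.dist b₁ o₁ + 1 = X.dist b o₁ ∧
      X.ChainEdges L 2 s(b, a) s(b, b₁)
  · obtain ⟨b₁, h1, h2, h3⟩ := hA
    have h4 := hturn o₁ b₁ h1 h2 h3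
    exact ⟨b, b₁, Or.inl ⟨h1, by omega⟩, h3.symm⟩
  · push Not at hA
    have hpass : ∀ r, r = x ∨ r = y → X.dist r b + X.dist b o₁ = X.dist r o₁ := by
      intro r hr
      by_contra hne
      have hbo : b ≠ o₁ := by rintro rfl; exact hne (by simp)
      obtain ⟨b₁, h1, h2⟩ := hc.exists_adj_dist hbo
      exact hA b₁ h1 h2 ((hang r hr o₁ b₁ h1 h2 hne).chain.mono (by omega))
    have hpz : X.dist o₁ b + X.dist b z = X.dist o₁ z := by
      by_contra hne
      have hbo : b ≠ o₁ := by rintro rfl; exact hne (by simp)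
      obtain ⟨b₁, h1, h2⟩ := hc.exists_adj_dist hbo
      have h3 := hT.closeEdges_of_dist_ne hc hL h1 h2 hb1 hb2 hne
      exact hA b₁ h1 h2 (hcl.chain.trans h3.symm.chain)
    have hbz1 := hc.pos_dist_of_ne hbz
    have h5 := hpass p h.eq_or
    have h6 := h.le_dist_p
    have c1 := X.dist_comm (u := o₁) (v := p)
    have c2 := X.dist_comm (u := o₁) (v := b)
    have c3 := X.dist_comm (u := b) (v := p)
    rcases hq p h.eq_or with rfl | h7
    · have := X.dist_self (v := p)
      omega
    have t1 := hc.dist_triangle (u := o₁) (v := b) (w := a)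
    have t2 := hc.dist_triangle (u := o₁) (v := a) (w := p)
    have h8 := h.same_c.between (a := a) (by omega) (by omega)
    exact ⟨b, a, Or.inr ⟨hadj, by omega⟩, (CloseEdges.refl _ _).chain.mono (by omega)⟩

/-- An edge of a geodesic from `o` which is followed by a vertex near a geodesic from `o` to `o₁`
is close to an edge of such a geodesic. -/
lemma HasThinTriangles.exists_traverses_of_near {δ L : ℕ} (hT : X.HasThinTriangles δ)
    (hc : X.Connected) (hL : 16 * δ + 4 ≤ L) {o o₁ x : V} {γ : X.Walk o x} (hγ : γ.IsGeodesic)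
    {i j : ℕ} (hij : i + 5 * δ + 2 ≤ j) (hj : j ≤ γ.length) {w : V}
    (hw : X.dist o w + X.dist w o₁ = X.dist o o₁) (hjw : X.dist (γ.getVert j) w ≤ 2 * δ) :
    ∃ s t, X.Traverses o s t o₁ ∧ X.CloseEdges L s(s, t) s(γ.getVert i, γ.getVert (i + 1)) := by
  obtain ⟨ω, hω⟩ := hc.exists_geodesic o w
  have g1 := (hγ.dist_getVert_right hc (i := i) (by omega)).1
  have g2 := (hγ.dist_getVert_right hc (i := j) (by omega)).1
  obtain ⟨m, rfl⟩ := Nat.exists_eq_add_of_le (show i + 1 ≤ j by omega)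
  have g3 := hγ.dist_getVert hc (i + 1) m (by omega)
  have g4 := hγ.dist_getVert hc i (m + 1) (by omega)
  rw [show i + (m + 1) = i + 1 + m by ring] at g4
  set q := γ.getVert (i + 1 + m)
  have hadj := γ.adj_getVert_succ (i := i) (by omega)
  obtain ⟨f, hf, hcl⟩ := hc.exists_closeEdges_of_fellow (L := L) (η := 2 * δ) (by omega)
    (p := o) (q := q) hadj (by omega) hω (by
      intro a ha ha'
      rcases hT.exists_right hc hω ha with ⟨b, hb, hab⟩ | ⟨b, hb, hab⟩
      · exact ⟨b, hb, by omega⟩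
      -- Here `a` would be within `3 * δ` of `q` and hence an end of the edge within `5 * δ` of `q`;
      -- the gap between `i` and `j` excludes this.
      · exfalso
        have t1 := hc.dist_triangle (u := a) (v := b) (w := q)
        have t2 := hc.dist_triangle (u := γ.getVert i) (v := a) (w := q)
        have t3 := hc.dist_triangle (u := γ.getVert (i + 1)) (v := a) (w := q)
        have c1 := X.dist_comm (u := q) (v := b)
        omega) (Or.inr ω.start_mem_support) (Or.inl (by omega))
  obtain ⟨s, t, rfl, hst, -⟩ := hω.exists_traverses hc (p := o) (q := o₁) (by simpa using hw) hf
  exact ⟨s, t, hst, hcl.symm⟩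

/-- Some `z` in the ball about `o₁` is seen from `x` or `y` past the ball of radius `k - 1` about
`o`, for otherwise this ball would be a gate transmitting the common view. Thin triangles then place
the geodesic, shortly before height `k`, either near a geodesic from `o` to `o₁` or near the ball
about `o₁`. In the second case a lower edge either is again close to a geodesic from `o` to `o₁`, or
is close to an edge on a geodesic from `o₁` to `p` inside this ball, where `p` may be replaced by
`c`. -/
lemma SplitPair.exists_isAnchored {δ L : ℕ} (hT : X.HasThinTriangles δ)
    (hc : X.Connected) (hL : 16 * δ + 4 ≤ L) {o o₁ : V} {k R : ℕ} {c x y p : V}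
    (h : X.SplitPair o o₁ k R c x y p) {γ : X.Walk o x} (hγ : γ.IsGeodesic)
    (hk : 4 * L + 12 * δ + 4 ≤ k) :
    ∃ i, k ≤ i + (4 * L + 12 * δ + 4) ∧ i < γ.length ∧
      X.IsAnchored L o o₁ c s(γ.getVert i, γ.getVert (i + 1)) := by
  have hlen : k ≤ γ.length := by
    have := h.le_dist
    unfold Walk.IsGeodesic at hγ
    omega
  have hpt : ∀ q, q = x ∨ q = y → ∀ i, i ≤ k - 1 →
      X.dist o (γ.getVert i) = i ∧ i + X.dist (γ.getVert i) q = X.dist o q := by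
    rintro q (rfl | rfl) i hi
    · have := hγ.dist_getVert_right hc (i := i) (by omega)
      omega
    · have h1 := hγ.dist_getVert_right hc (i := i) (by omega)
      have h2 := h.same.between (a := γ.getVert i) (by omega) (by omega)
      omega
  have hseg : ∀ i n, i + n ≤ k - 1 → X.dist (γ.getVert i) (γ.getVert (i + n)) = n :=
    fun i n hin => hγ.dist_getVert hc i n (by omega)
  obtain ⟨n, hn⟩ := Nat.exists_eq_add_of_le hk
  -- the levels used below: `i₀ < i₁ < i₂ < i₃ < k`
  have hnear : ∀ j, n + 5 * δ + 2 ≤ j → j ≤ k - 1 → ∀ w,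
      X.dist o w + X.dist w o₁ = X.dist o o₁ → X.dist (γ.getVert j) w ≤ 2 * δ →
      ∃ i, k ≤ i + (4 * L + 12 * δ + 4) ∧ i < γ.length ∧
      X.IsAnchored L o o₁ c s(γ.getVert i, γ.getVert (i + 1)) := by
    intro j h1 h2 w h3 h4
    obtain ⟨s, t, hst, hcl⟩ := hT.exists_traverses_of_near hc hL hγ (i := n) h1 (by omega) h3 h4
    exact ⟨n, by omega, by omega, s, t, Or.inl hst, hcl.chain.mono (by omega)⟩
  -- a vertex of the second ball seen from `x` or `y` without crossing the first ball
  obtain ⟨z, hzR, q, hq, hz⟩ : ∃ z, X.dist o₁ z ≤ R ∧ ∃ q, (q = x ∨ q = y) ∧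
      ∀ w, X.dist o w ≤ k - 1 → X.dist q w + X.dist w z ≠ X.dist q z := by
    by_contra hcon
    push Not at hcon
    have key : ∀ z, X.dist o₁ z ≤ R → X.dist x z + X.dist y o = X.dist y z + X.dist x o := by
      intro z hz
      refine hc.dist_add_of_gate (W := {w | X.dist o w ≤ k - 1}) (by simp) ?_
        (hcon z hz x (Or.inl rfl)) (hcon z hz y (Or.inr rfl))
      intro w hw w' hw'
      have h1 := h.same w hw
      have h2 := h.same w' hw'
      omega
    refine h.not_same fun z hz => ?_
    have h1 := key z hz
    have h2 := key o₁ (by simp)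
    omega
  have h3 := hpt q hq (k - 1 - δ) (by omega)
  set w := γ.getVert (k - 1 - δ) with hw
  obtain ⟨b, hb, hwb⟩ : ∃ b, X.dist o b + X.dist b z = X.dist o z ∧ X.dist w b ≤ δ := by
    rcases hT.exists_between hc (x := o) (y := q) (a := w) z (by omega) with
      ⟨b, hb, hwb⟩ | hb
    -- The level `k - 1 - δ` of `w` leaves room for an error `δ`: this `b` would lie in the ball
    -- which geodesics from `q` to `z` avoid.
    · have := hc.dist_triangle (u := o) (v := w) (w := b)
      exact absurd hb (hz b (by omega))
    · exact hb
  have tw := hc.dist_triangle (u := o₁) (v := b) (w := w)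
  have cw := X.dist_comm (u := w) (v := b)
  have hwR : (∃ i, k ≤ i + (4 * L + 12 * δ + 4) ∧ i < γ.length ∧
      X.IsAnchored L o o₁ c s(γ.getVert i, γ.getVert (i + 1))) ∨ X.dist o₁ w ≤ R + 2 * δ := by
    rcases hT.exists_between hc o₁ hb with ⟨b', hb', hbb'⟩ | ⟨b', hb', hbb'⟩
    · right
      have t1 := hc.dist_triangle (u := o₁) (v := b') (w := b)
      have c1 := X.dist_comm (u := b') (v := b)
      have c2 := X.dist_comm (u := o₁) (v := b')
      have c3 := X.dist_comm (u := o₁) (v := z)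
      omega
    · left
      have t1 := hc.dist_triangle (u := w) (v := b) (w := b')
      exact hnear (k - 1 - δ) (by omega) (by omega) b' hb' (by rw [← hw]; omega)
  rcases hwR with hwR | hwR
  · exact hwR
  -- the same for a vertex closer to `o`, with `p`
  obtain ⟨g1, g2⟩ := hpt p h.eq_or (n + 5 * δ + 2) (by omega)
  obtain ⟨g3, g4⟩ := hpt p h.eq_or (n + 9 * δ + 3) (by omega)
  obtain ⟨g5, g6⟩ := hpt p h.eq_or (n + 9 * δ + 3 + 1) (by omega)
  obtain ⟨g7, g8⟩ := hpt p h.eq_or (k - 1 - δ) (by omega)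
  have g9 := hseg (n + 5 * δ + 2) (4 * δ + 1) (by omega)
  have g10 := hseg (n + 5 * δ + 2) (4 * δ + 2) (by omega)
  rw [show n + 5 * δ + 2 + (4 * δ + 1) = n + 9 * δ + 3 by ring] at g9
  rw [show n + 5 * δ + 2 + (4 * δ + 2) = n + 9 * δ + 3 + 1 by ring] at g10
  have hadj := γ.adj_getVert_succ (i := n + 9 * δ + 3) (by omega)
  have hfin := hnear (n + 5 * δ + 2) le_rfl (by omega)
  rw [← hw] at g7 g8
  set w' := γ.getVert (n + 5 * δ + 2) with hw'
  set e₁ := γ.getVert (n + 9 * δ + 3) with he₁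
  set e₂ := γ.getVert (n + 9 * δ + 3 + 1) with he₂
  rcases hT.exists_between hc (x := o) (y := p) (a := w') o₁ (by omega) with
    ⟨b₁, hb₁, hwb₁⟩ | ⟨b₁, hb₁, hwb₁⟩
  · obtain ⟨ω, hω⟩ := hc.exists_geodesic b₁ p
    have cb1 := X.dist_comm (u := p) (v := b₁)
    have cb2 := X.dist_comm (u := o₁) (v := b₁)
    have cb3 := X.dist_comm (u := o₁) (v := p)
    obtain ⟨f, hf, hcl⟩ := hc.exists_closeEdges_of_fellow (L := L) (η := 2 * δ) (by omega)
      (p := w') (q := p) hadj (by omega) hω (by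
        intro a ha ha'
        rcases hT.exists_left hc hω.reverse ha with ⟨m, hm, ham⟩ | ⟨m, hm, ham⟩
        · exact ⟨m, by simpa using hm, by omega⟩
        · exfalso
          have t1 := hc.dist_triangle (u := w') (v := m) (w := a)
          have t2 := hc.dist_triangle (u := w') (v := a) (w := e₁)
          have t3 := hc.dist_triangle (u := w') (v := a) (w := e₂)
          have c1 := X.dist_comm (u := a) (v := m)
          have c2 := X.dist_comm (u := a) (v := e₁)
          have c3 := X.dist_comm (u := a) (v := e₂)
          omega) (Or.inl (by omega)) (Or.inr ω.end_mem_support)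
    obtain ⟨s, t, rfl, hst, -⟩ := hω.exists_traverses hc (p := o₁) (q := p)
      (by rw [X.dist_self]; omega) hf
    have d1 := hcl.dist_le hc (by omega) (by rwa [mem_edgeSet]) (Sym2.mem_mk_left e₁ e₂)
      (Sym2.mem_mk_right s t)
    have d2 := hst.dist_fst hc
    obtain ⟨hst1, hst2⟩ := hst
    have t1 := hc.dist_triangle (u := e₁) (v := t) (w := p)
    have t2 := hc.dist_triangle (u := o₁) (v := w) (w := p)
    -- The vertex `w` lies `4 * L + 2 * δ` beyond `e₁`, which outweighs the distance of at most `2 *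
    -- L` from `e₁` to `t` and the excess `2 * δ` in `hwR`. So `t` is in the ball of radius `R`
    -- about `o₁`.
    have h8 := h.same_c.between (a := t) (by omega) (by omega)
    exact ⟨n + 9 * δ + 3, by omega, by omega, s, t, Or.inr ⟨hst1, by omega⟩,
      hcl.symm.chain.mono (by omega)⟩
  · exact hfin b₁ hb₁ (by omega)

/-- The vertex `x` of a split pair is bounded in terms of the geodesics from `o` to `o₁` and from
`o₁` to `c`. -/
lemma SplitPair.exists_mem_chainEnds {δ L C : ℕ} (hT : X.HasThinTriangles δ)
    (hc : X.Connected) (hL : 16 * δ + 4 ≤ L) {o o₁ : V} {k R : ℕ} {c x y p : V}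
    (h : X.SplitPair o o₁ k R c x y p) (hC : X.dist o x ≤ k + C) :
    ∃ s t, (X.Traverses o s t o₁ ∨ X.Traverses o₁ s t c) ∧
      x ∈ X.chainEnds L (2 + 3 * (C + (4 * L + 12 * δ + 4))) s(s, t) := by
  obtain ⟨γ, hγ⟩ := hc.exists_geodesic o x
  have hlen : γ.length = X.dist o x := hγ
  have h1 := h.le_dist
  have h2 := h.pos
  set K := 4 * L + 12 * δ + 4 with hK
  -- The last anchored edge is chosen. No turn follows it, since edges leaving turns are anchored;
  -- from there to `x` each vertex costs at most three steps.
  obtain ⟨i, hi1, hi2, hi3, hmax⟩ : ∃ i, k ≤ i + K ∧ i < γ.length ∧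
      X.IsAnchored L o o₁ c s(γ.getVert i, γ.getVert (i + 1)) ∧
      ∀ j, i < j → j < γ.length → ¬ X.IsAnchored L o o₁ c s(γ.getVert j, γ.getVert (j + 1)) := by
    classical
    set P : ℕ → Prop := fun i => k ≤ i + K ∧ i < γ.length ∧
      X.IsAnchored L o o₁ c s(γ.getVert i, γ.getVert (i + 1)) with hP
    have hex : ∃ i, i ≤ γ.length ∧ P i := by
      rcases Nat.lt_or_ge k K with hk | hk
      -- For small `k` the origin supplies an anchored edge; this is why it counts as a turn.
      · refine ⟨0, by omega, by omega, by omega, ?_⟩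
        exact h.isAnchored_of_isTurn hT hc (by omega) hγ (by omega) (Or.inl rfl)
      · obtain ⟨i, h3, h4, h5⟩ := h.exists_isAnchored hT hc hL hγ hk
        exact ⟨i, h4.le, h3, h4, h5⟩
    obtain ⟨i₀, hi₀, hPi₀⟩ := hex
    have hg := Nat.findGreatest_spec (P := P) hi₀ hPi₀
    refine ⟨Nat.findGreatest P γ.length, hg.1, hg.2.1, hg.2.2, fun j hj1 hj2 hj3 => ?_⟩
    exact Nat.findGreatest_is_greatest hj1 hj2.le ⟨by have := hg.1; omega, hj2, hj3⟩
  have hchain : ∀ m, i + m < γ.length → X.ChainEdges L (3 * m) s(γ.getVert i, γ.getVert (i + 1))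
      s(γ.getVert (i + m), γ.getVert (i + m + 1)) := by
    intro m
    induction m with
    | zero => intro _; exact rfl
    | succ m ih =>
      intro hm
      have h3 : ¬ γ.IsTurn L (i + (m + 1)) := fun ht =>
        hmax _ (by omega) hm (h.isAnchored_of_isTurn hT hc (by omega) hγ hm ht)
      unfold Walk.IsTurn at h3
      push Not at h3
      exact (ih (by omega)).trans h3.2
  obtain ⟨s, t, hst, hcl⟩ := hi3
  obtain ⟨m, hm⟩ := Nat.exists_eq_add_of_lt hi2
  refine ⟨s, t, hst, _, (hcl.trans (hchain m (by omega))).mono (by omega), ?_⟩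
  rw [show i + m + 1 = γ.length by omega, γ.getVert_length]
  exact Sym2.mem_mk_right _ _

/-- Edges traversed by geodesics with the same ends are close. -/
lemma HasThinTriangles.exists_closeEdges_geodesic {δ L : ℕ} (hT : X.HasThinTriangles δ)
    (hc : X.Connected) (hL : 16 * δ + 4 ≤ L) {p s t q : V} (h : X.Traverses p s t q)
    {γ : X.Walk p q} (hγ : γ.IsGeodesic) : ∃ f ∈ γ.edges, X.CloseEdges L f s(s, t) := by
  obtain ⟨f, hf, hcl⟩ := hc.exists_closeEdges_of_fellow (L := L) (η := 2 * δ) (by omega)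
    h.1 h.2 hγ (by
      intro a ha _
      rcases hT.exists_right hc hγ ha with ⟨b, hb, hab⟩ | ⟨b, hb, hab⟩
      · exact ⟨b, hb, by omega⟩
      · rw [X.dist_self] at hb
        obtain rfl : q = b := hc.dist_eq_zero_iff.1 (by omega)
        exact ⟨q, γ.end_mem_support, by omega⟩)
    (Or.inr γ.start_mem_support) (Or.inr γ.end_mem_support)
  exact ⟨f, hf, hcl.symm⟩

/-- For given `c`, `R` and `k` the number of split pairs is bounded linearly in the distance of the
base points. -/
theorem IsUniformlyFine.exists_encard_splitPair_le {δ : ℕ} (hf : X.IsUniformlyFine)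
    (hT : X.HasThinTriangles δ) (hc : X.Connected) (C : ℕ) :
    ∃ A : ℕ, ∀ (o o₁ : V) (k R : ℕ) (c : V),
      {x | X.dist o x ≤ k + C ∧ ∃ y p, X.SplitPair o o₁ k R c x y p}.encard ≤
        A * (X.dist o o₁ + 1) := by
  set L := 16 * δ + 4 with hL
  set n := 2 + 3 * (C + (4 * L + 12 * δ + 4)) with hn
  -- The additional step passes from an arbitrary geodesic to the fixed geodesics `γ` and `ω`.
  obtain ⟨N, hN⟩ := hf.exists_encard_chainEnds_le L (n + 1)
  set B := C + (2 * L * (n + 1) + 1) with hB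
  refine ⟨(2 * B + 4) * N, fun o o₁ k R c => ?_⟩
  set d := X.dist o o₁ with hd
  obtain ⟨γ, hγ⟩ := hc.exists_geodesic o o₁
  obtain ⟨ω, hω⟩ := hc.exists_geodesic o₁ c
  classical
  let E₁ : Finset (Sym2 V) := γ.edges.toFinset
  -- The geodesic `ω` may be long, but `d(o, x)` is between `k` and `k + C` and `x` is within `2 * L
  -- * (n + 1) + 1` of the edge used. Only a window of `ω` of size linear in `d` matters.
  let E₂ : Finset (Sym2 V) := ((Finset.Icc (k - d - B) (k + d + B)).filter (· < ω.length)).image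
    fun i => s(ω.getVert i, ω.getVert (i + 1))
  have hE : ∀ e ∈ E₁ ∪ E₂, e ∈ X.edgeSet := by
    intro e he
    rcases Finset.mem_union.1 he with he | he
    · exact γ.edges_subset_edgeSet (List.mem_toFinset.1 he)
    · simp only [E₂, Finset.mem_image, Finset.mem_filter] at he
      obtain ⟨i, ⟨-, hi⟩, rfl⟩ := he
      exact ω.adj_getVert_succ hi
  have hcard : (E₁ ∪ E₂).card ≤ (2 * B + 4) * (d + 1) := by
    refine (Finset.card_union_le _ _).trans ?_
    have h1 : E₁.card ≤ d := by
      refine (List.toFinset_card_le _).trans ?_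
      rw [Walk.length_edges]
      exact hγ.le
    have h2 : E₂.card ≤ k + d + B + 1 - (k - d - B) := by
      refine Finset.card_image_le.trans ((Finset.card_filter_le _ _).trans ?_)
      rw [Nat.card_Icc]
    have h3 : (2 * B + 4) * (d + 1) = 2 * B * d + 4 * d + 2 * B + 4 := by ring
    have h4 : 0 ≤ 2 * B * d := by positivity
    omega
  have hfin : ∀ e ∈ E₁ ∪ E₂, (X.chainEnds L (n + 1) e).Finite := fun e he =>
    Set.finite_of_encard_le_coe (hN e (hE e he))
  let F : Sym2 V → Finset V := fun e => if h : e ∈ E₁ ∪ E₂ then (hfin e h).toFinset else ∅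
  have hsub : {x | X.dist o x ≤ k + C ∧ ∃ y p, X.SplitPair o o₁ k R c x y p} ⊆
      ((E₁ ∪ E₂).biUnion F : Finset V) := by
    rintro x ⟨hx, y, p, h⟩
    have hmem : ∀ e ∈ E₁ ∪ E₂, x ∈ X.chainEnds L (n + 1) e →
        x ∈ ((E₁ ∪ E₂).biUnion F : Finset V) := by
      intro e he hxe
      rw [Finset.mem_biUnion]
      refine ⟨e, he, ?_⟩
      simp only [F, dif_pos he, Set.Finite.mem_toFinset]
      exact hxe
    obtain ⟨s, t, hst | hst, f, hf1, hf2⟩ := h.exists_mem_chainEnds hT hc hL.ge hx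
    · obtain ⟨e, he, hcl⟩ := hT.exists_closeEdges_geodesic hc hL.ge hst hγ
      exact hmem e (Finset.mem_union_left _ (List.mem_toFinset.2 he))
        ⟨f, (hcl.chain.trans hf1).mono (by omega), hf2⟩
    · obtain ⟨e, he, hcl⟩ := hT.exists_closeEdges_geodesic hc hL.ge hst hω
      obtain ⟨i, hi, rfl, hadj, hi1, -⟩ := hω.exists_of_mem_edges hc he
      have hch : X.ChainEdges L (n + 1) s(ω.getVert i, ω.getVert (i + 1)) f :=
        (hcl.chain.trans hf1).mono (by omega)
      have hdist := hch.dist_le hc (by omega) (by rwa [mem_edgeSet]) (Sym2.mem_mk_left _ _) hf2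
      refine hmem _ (Finset.mem_union_right _ ?_) ⟨f, hch, hf2⟩
      simp only [E₂, Finset.mem_image, Finset.mem_filter, Finset.mem_Icc]
      refine ⟨i, ⟨⟨?_, ?_⟩, hi⟩, rfl⟩
      · have t1 := hc.dist_triangle (u := o) (v := o₁) (w := ω.getVert i)
        have t2 := hc.dist_triangle (u := o) (v := ω.getVert i) (w := x)
        have := h.le_dist
        omega
      · have t1 := hc.dist_triangle (u := o₁) (v := o) (w := ω.getVert i)
        have t2 := hc.dist_triangle (u := o) (v := x) (w := ω.getVert i)
        have c1 := X.dist_comm (u := x) (v := ω.getVert i)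
        have c2 := X.dist_comm (u := o₁) (v := o)
        omega
  refine (Set.encard_le_encard hsub).trans ?_
  rw [Set.encard_coe_eq_coe_finsetCard]
  have h1 : ((E₁ ∪ E₂).biUnion F).card ≤ (E₁ ∪ E₂).card * N := by
    refine Finset.card_biUnion_le_card_mul _ _ _ fun e he => ?_
    simp only [F, dif_pos he]
    have := hN e (hE e he)
    rw [(hfin e he).encard_eq_coe_toFinset_card] at this
    exact_mod_cast this
  have h2 := h1.trans (Nat.mul_le_mul_right N hcard)
  rw [mul_right_comm] at h2
  exact_mod_cast h2

end View

end SimpleGraph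

namespace SimpleGraph

/-! ### Cofinite actions: nearest vertices and views of remote balls -/

section Action

variable {V : Type*} {X : SimpleGraph V} {G : Type*} [Group G] [MulAction G V]

/-- The action is by graph automorphisms. -/
def IsPreservedBy (X : SimpleGraph V) (G : Type*) [Group G] [MulAction G V] : Prop :=
  ∀ (g : G) (x y : V), X.Adj x y → X.Adj (g • x) (g • y)

/-- The graph automorphism given by a group element. -/
def IsPreservedBy.hom (h : X.IsPreservedBy G) (g : G) : X →g X where
  toFun := (g • ·)
  map_rel' := h g _ _

lemma IsPreservedBy.dist_smul (h : X.IsPreservedBy G) (hc : X.Connected) (g : G) (x y : V) :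
    X.dist (g • x) (g • y) = X.dist x y := by
  have key : ∀ (g : G) (x y : V), X.dist (g • x) (g • y) ≤ X.dist x y := by
    intro g x y
    obtain ⟨γ, hγ⟩ := hc.exists_geodesic x y
    have h1 := X.dist_le (γ.map (h.hom g))
    rw [Walk.length_map] at h1
    exact h1.trans hγ.le
  refine le_antisymm (key g x y) ?_
  simpa using key g⁻¹ (g • x) (g • y)

lemma IsPreservedBy.sameView_smul (h : X.IsPreservedBy G) (hc : X.Connected) (g : G) {o x y : V}
    {k : ℕ} (hxy : X.SameView o k x y) : X.SameView (g • o) k (g • x) (g • y) := by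
  intro z hz
  have h1 := hxy (g⁻¹ • z) (by rw [← h.dist_smul hc g]; simpa using hz)
  rw [← h.dist_smul hc g x, ← h.dist_smul hc g y, ← h.dist_smul hc g y,
    ← h.dist_smul hc g x] at h1
  simpa using h1

lemma IsPreservedBy.sameView_smul_iff (h : X.IsPreservedBy G) (hc : X.Connected) (g : G)
    {o x y : V} {k : ℕ} : X.SameView (g • o) k (g • x) (g • y) ↔ X.SameView o k x y := by
  refine ⟨fun hxy => ?_, h.sameView_smul hc g⟩
  simpa using h.sameView_smul hc g⁻¹ hxy

lemma IsPreservedBy.closeEdges_map (h : X.IsPreservedBy G) (g : G) {L : ℕ} {e f : Sym2 V}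
    (hef : X.CloseEdges L e f) : X.CloseEdges L (e.map (g • ·)) (f.map (g • ·)) := by
  rcases hef with rfl | ⟨x, c, h1, h2, h3, h4⟩
  · exact CloseEdges.refl _ _
  · refine Or.inr ⟨h.hom g x, c.map (h.hom g),
      h1.map (f := h.hom g) (MulAction.injective g), ?_, ?_, ?_⟩
    · rwa [Walk.length_map]
    · rw [Walk.edges_map]
      exact List.mem_map_of_mem (f := Sym2.map (h.hom g)) h3
    · rw [Walk.edges_map]
      exact List.mem_map_of_mem (f := Sym2.map (h.hom g)) h4

lemma IsPreservedBy.chainEdges_map (h : X.IsPreservedBy G) (g : G) {L n : ℕ} {e f : Sym2 V}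
    (hef : X.ChainEdges L n e f) : X.ChainEdges L n (e.map (g • ·)) (f.map (g • ·)) := by
  induction n generalizing f with
  | zero => obtain rfl : e = f := hef; exact rfl
  | succ n ih =>
    obtain ⟨e', h1, h2⟩ := hef
    exact ⟨_, ih h1, h.closeEdges_map g h2⟩

lemma IsPreservedBy.smul_mem_chainEnds (h : X.IsPreservedBy G) (g : G) {L n : ℕ} {e : Sym2 V}
    {x : V} (hx : x ∈ X.chainEnds L n e) : g • x ∈ X.chainEnds L n (e.map (g • ·)) := by
  obtain ⟨f, h1, h2⟩ := hx
  exact ⟨_, h.chainEdges_map g h1, Sym2.mem_map.2 ⟨x, h2, rfl⟩⟩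

/-- There are finitely many orbits of edges. -/
def IsEdgeCofinite (X : SimpleGraph V) (G : Type*) [Group G] [MulAction G V] : Prop :=
  ∃ F : Finset (Sym2 V), ∀ e ∈ X.edgeSet, ∃ g : G, ∃ e₀ ∈ F, e₀.map (g • ·) = e

/-- Up to additive constants, there are finitely many functions which arise by restricting the
distance to a vertex to a finite set. -/
lemma Connected.exists_finset_dist_add (hc : X.Connected) {W : Set V} (hW : W.Finite) :
    ∃ Z : Finset V, ∀ x, ∃ y ∈ Z, ∀ w ∈ W, ∀ w' ∈ W,
      X.dist x w + X.dist y w' = X.dist x w' + X.dist y w := by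
  rcases W.eq_empty_or_nonempty with rfl | ⟨w₀, hw₀⟩
  · exact ⟨{hc.nonempty.some}, fun x => ⟨_, Finset.mem_singleton_self _, by simp⟩⟩
  have : Finite W := hW
  let τ : V → W → ℤ := fun x w => (X.dist x w : ℤ) - X.dist x w₀
  have hfin : (Set.range τ).Finite := by
    refine (Set.Finite.pi' (t := fun w : W => Set.Icc (-(X.dist w₀ w : ℤ)) (X.dist w₀ w))
      fun w => Set.finite_Icc _ _).subset ?_
    rintro _ ⟨x, rfl⟩ w
    have h1 := hc.dist_triangle (u := x) (v := w₀) (w := w)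
    have h2 := hc.dist_triangle (u := x) (v := w) (w := w₀)
    have h3 := X.dist_comm (u := w₀) (v := w)
    simp only [τ, Set.mem_Icc]
    omega
  have : Finite (Set.range τ) := hfin
  refine ⟨(Set.finite_range (Set.rangeSplitting τ)).toFinset, fun x =>
    ⟨Set.rangeSplitting τ ⟨τ x, x, rfl⟩, by simp, fun w hw w' hw' => ?_⟩⟩
  have h1 := Set.apply_rangeSplitting τ ⟨τ x, x, rfl⟩
  generalize Set.rangeSplitting τ ⟨τ x, x, rfl⟩ = y at h1 ⊢
  have h2 : (X.dist y w : ℤ) - X.dist y w₀ = X.dist x w - X.dist x w₀ := congrFun h1 ⟨w, hw⟩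
  have h3 : (X.dist y w' : ℤ) - X.dist y w₀ = X.dist x w' - X.dist x w₀ := congrFun h1 ⟨w', hw'⟩
  omega

/-- A finite set of model vertices is chosen at each of finitely many representative edges and
transported by the group. The bounds are therefore uniform, also for the distance of the models from
the edge. -/
lemma IsEdgeCofinite.exists_finset_dist_add (hG : X.IsEdgeCofinite G) (h : X.IsPreservedBy G)
    (hc : X.Connected) (hf : X.IsUniformlyFine) (L n : ℕ) :
    ∃ A : ℕ, ∀ e ∈ X.edgeSet, ∃ Z : Finset V, Z.card ≤ A ∧ (∀ y ∈ Z, ∀ x ∈ e, X.dist x y ≤ A) ∧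
      ∀ x, ∃ y ∈ Z, ∀ w ∈ X.chainEnds L n e, ∀ w' ∈ X.chainEnds L n e,
        X.dist x w + X.dist y w' = X.dist x w' + X.dist y w := by
  obtain ⟨F, hF⟩ := hG
  obtain ⟨N, hN⟩ := hf.exists_encard_chainEnds_le L n
  have key : ∀ e : Sym2 V, ∃ (A : ℕ) (Z : Finset V), e ∈ X.edgeSet →
      Z.card ≤ A ∧ (∀ y ∈ Z, ∀ x ∈ e, X.dist x y ≤ A) ∧
      ∀ x, ∃ y ∈ Z, ∀ w ∈ X.chainEnds L n e, ∀ w' ∈ X.chainEnds L n e,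
        X.dist x w + X.dist y w' = X.dist x w' + X.dist y w := by
    classical
    intro e
    by_cases he : e ∈ X.edgeSet
    · obtain ⟨Z, hZ⟩ := hc.exists_finset_dist_add (Set.finite_of_encard_le_coe (hN e he))
      refine ⟨Z.card + ∑ y ∈ Z, ∑ x ∈ e.toFinset, X.dist x y, Z, fun _ => ⟨by omega, ?_, hZ⟩⟩
      intro y hy x hx
      have h1 : X.dist x y ≤ ∑ x ∈ e.toFinset, X.dist x y :=
        Finset.single_le_sum (f := fun x => X.dist x y) (fun _ _ => Nat.zero_le _)
          (by simpa using hx)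
      have h2 : ∑ x ∈ e.toFinset, X.dist x y ≤ ∑ y ∈ Z, ∑ x ∈ e.toFinset, X.dist x y :=
        Finset.single_le_sum (f := fun y => ∑ x ∈ e.toFinset, X.dist x y)
          (fun _ _ => Nat.zero_le _) hy
      omega
    · exact ⟨0, ∅, fun h => absurd h he⟩
  choose A Z hZ using key
  refine ⟨∑ e ∈ F, A e, fun e he => ?_⟩
  obtain ⟨g, e₀, he₀, rfl⟩ := hF e he
  have hinv : (e₀.map (g • ·)).map (g⁻¹ • ·) = e₀ := by
    induction e₀ using Sym2.ind
    simp
  have hmap : ∀ (g : G) (e : Sym2 V), e ∈ X.edgeSet → e.map (g • ·) ∈ X.edgeSet := by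
    intro g e he
    induction e using Sym2.ind with
    | _ s t => exact h g s t he
  have he₀X : e₀ ∈ X.edgeSet := by
    have := hmap g⁻¹ _ he
    rwa [hinv] at this
  obtain ⟨h1, h2, h3⟩ := hZ e₀ he₀X
  have hA : A e₀ ≤ ∑ e ∈ F, A e := Finset.single_le_sum (fun _ _ => Nat.zero_le _) he₀
  classical
  refine ⟨(Z e₀).image (g • ·), Finset.card_image_le.trans (h1.trans hA), ?_, fun x => ?_⟩
  · intro y hy x hx
    obtain ⟨y', hy', rfl⟩ := Finset.mem_image.1 hy
    obtain ⟨x', hx', rfl⟩ := Sym2.mem_map.1 hx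
    rw [h.dist_smul hc]
    exact (h2 y' hy' x' hx').trans hA
  · obtain ⟨y, hy, hxy⟩ := h3 (g⁻¹ • x)
    refine ⟨g • y, Finset.mem_image_of_mem _ hy, fun w hw w' hw' => ?_⟩
    have hw1 := h.smul_mem_chainEnds g⁻¹ hw
    have hw1' := h.smul_mem_chainEnds g⁻¹ hw'
    rw [hinv] at hw1 hw1'
    have h4 := hxy _ hw1 _ hw1'
    rw [h.dist_smul hc, h.dist_smul hc, ← h.dist_smul hc g y, ← h.dist_smul hc g y] at h4
    simpa using h4

/-- Geodesics to `q` from two points `a`, `z` of a ball merge outside its `4 * δ`-neighbourhood. A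
vertex within `2 * δ` of the edge and within `δ` of a side from `a` to `z` would be within `2 * δ`
of a side from `a` or `z` to `o`, which stays in the ball. -/
lemma HasThinTriangles.exists_closeEdges_of_ball {δ L : ℕ} (hT : X.HasThinTriangles δ)
    (hc : X.Connected) (hL : 16 * δ + 4 ≤ L) {o a u v q z : V} {k : ℕ}
    (ha : X.dist o a ≤ k) (hz : X.dist o z ≤ k) (hu : k + 4 * δ + 1 ≤ X.dist o u)
    (hv : k + 4 * δ + 1 ≤ X.dist o v)
    (h : X.Traverses a u v q) {γ : X.Walk z q} (hγ : γ.IsGeodesic) :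
    ∃ f ∈ γ.edges, X.CloseEdges L s(u, v) f := by
  have t0 := hc.dist_triangle (u := o) (v := a) (w := u)
  refine hc.exists_closeEdges_of_fellow (L := L) (η := 2 * δ) (by omega) h.1 h.2 hγ ?_
    (Or.inl (by omega)) (Or.inr γ.end_mem_support)
  intro t ht ht'
  rcases hT.exists_left hc hγ.reverse ht with ⟨b, hb, hab⟩ | ⟨b, hb, hab⟩
  · exact ⟨b, by simpa using hb, by omega⟩
  · exfalso
    have t1 := hc.dist_triangle (u := o) (v := t) (w := u)
    have t2 := hc.dist_triangle (u := o) (v := t) (w := v)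
    have t3 := hc.dist_triangle (u := o) (v := b) (w := t)
    have c1 := X.dist_comm (u := t) (v := u)
    have c2 := X.dist_comm (u := t) (v := v)
    have c3 := X.dist_comm (u := t) (v := b)
    rcases hT.exists_between hc o hb with ⟨m, hm, hbm⟩ | ⟨m, hm, hbm⟩
    · have t4 := hc.dist_triangle (u := o) (v := m) (w := b)
      have c4 := X.dist_comm (u := m) (v := b)
      have c5 := X.dist_comm (u := m) (v := o)
      have c6 := X.dist_comm (u := z) (v := o)
      omega
    · have t4 := hc.dist_triangle (u := o) (v := m) (w := b)
      have c4 := X.dist_comm (u := m) (v := b)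
      have c5 := X.dist_comm (u := m) (v := o)
      have c6 := X.dist_comm (u := a) (v := o)
      omega

lemma Walk.IsGeodesic.exists_mem_chainEnds (hc : X.Connected) {L n : ℕ} {z q : V} {e f : Sym2 V}
    (hn : 1 ≤ n) {γ : X.Walk z q} (hγ : γ.IsGeodesic) (hf : f ∈ γ.edges) (h : X.CloseEdges L e f) :
    ∃ w ∈ X.chainEnds L n e, X.dist q w + X.dist w z = X.dist q z := by
  obtain ⟨i, hi, rfl, h1⟩ := hγ.exists_of_mem_edges hc hf
  refine ⟨γ.getVert i, ⟨_, h.chain.mono hn, Sym2.mem_mk_left _ _⟩, ?_⟩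
  have h2 := hγ.dist_add_dist hc (γ.getVert_mem_support i)
  have c1 := X.dist_comm (u := q) (v := γ.getVert i)
  have c2 := X.dist_comm (u := z) (v := γ.getVert i)
  have c3 := X.dist_comm (u := q) (v := z)
  omega

/-- A nearest vertex for the radius `k` is close to the ball of this radius. -/
theorem IsEdgeCofinite.exists_dist_le_of_isNearest {δ : ℕ} (hG : X.IsEdgeCofinite G)
    (h : X.IsPreservedBy G) (hc : X.Connected) (hf : X.IsUniformlyFine)
    (hT : X.HasThinTriangles δ) :
    ∃ C : ℕ, ∀ (o : V) (k : ℕ) (x : V), X.IsNearest o k x → X.dist o x ≤ k + C := by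
  set L := 16 * δ + 4 with hL
  set s := 4 * δ + 1 with hs
  obtain ⟨A, hA⟩ := hG.exists_finset_dist_add h hc hf L (3 * s + 1)
  refine ⟨s + 2 + A, fun o k x hx => ?_⟩
  by_contra hlt
  obtain ⟨γ, hγ⟩ := hc.exists_geodesic o x
  have hlen : γ.length = X.dist o x := hγ
  have hchain : ∀ m, k + m < γ.length → X.ChainEdges L (3 * m) s(γ.getVert k, γ.getVert (k + 1))
      s(γ.getVert (k + m), γ.getVert (k + m + 1)) := by
    intro m
    induction m with
    | zero => intro _; exact rfl
    | succ m ih =>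
      intro hm
      have h3 : ¬ γ.IsTurn L (k + (m + 1)) := fun ht => by
        have := hx.lt_of_isTurn hT hc (by omega) hγ hm ht
        omega
      unfold Walk.IsTurn at h3
      push Not at h3
      exact (ih (by omega)).trans h3.2
  have hch := (hchain s (by omega)).symm
  obtain ⟨g1, g2⟩ := hγ.dist_getVert_right hc (i := k) (by omega)
  obtain ⟨g3, g4⟩ := hγ.dist_getVert_right hc (i := k + s) (by omega)
  obtain ⟨g5, g6⟩ := hγ.dist_getVert_right hc (i := k + s + 1) (by omega)
  have g7 := hγ.dist_getVert hc k s (by omega)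
  have hadj := γ.adj_getVert_succ (i := k + s) (by omega)
  set a := γ.getVert k
  set u := γ.getVert (k + s)
  set v := γ.getVert (k + s + 1)
  -- Above height `k` there are no turns, so `a` is reached by a chain from the edge `uv`. A model
  -- `y` with the distances of `x` on the chain ends, up to a constant, keeps `uv` on a geodesic
  -- from `a`. The chain ends are then a gate for both `x` and `y`, so `y` looks like `x` and bounds
  -- its distance from `o`.
  obtain ⟨Z, -, hZ1, hZ2⟩ := hA s(u, v) hadj
  obtain ⟨y, hy, hxy⟩ := hZ2 x
  have haW : a ∈ X.chainEnds L (3 * s + 1) s(u, v) :=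
    ⟨_, hch.mono (by omega), Sym2.mem_mk_left _ _⟩
  have huW : u ∈ X.chainEnds L (3 * s + 1) s(u, v) :=
    ⟨_, (CloseEdges.refl _ _).chain.mono (by omega), Sym2.mem_mk_left _ _⟩
  have hvW : v ∈ X.chainEnds L (3 * s + 1) s(u, v) :=
    ⟨_, (CloseEdges.refl _ _).chain.mono (by omega), Sym2.mem_mk_right _ _⟩
  have e1 := hxy a haW v hvW
  have e2 := hxy u huW v hvW
  have c1 := X.dist_comm (u := x) (v := a)
  have c2 := X.dist_comm (u := x) (v := u)
  have c3 := X.dist_comm (u := x) (v := v)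
  have c4 := X.dist_comm (u := y) (v := a)
  have c6 := X.dist_comm (u := y) (v := v)
  have hgate : ∀ q, X.Traverses a u v q → ∀ z, X.dist o z ≤ k →
      ∃ w ∈ X.chainEnds L (3 * s + 1) s(u, v), X.dist q w + X.dist w z = X.dist q z := by
    intro q hq z hz
    obtain ⟨ω, hω⟩ := hc.exists_geodesic z q
    obtain ⟨f, hf, hcl⟩ := hT.exists_closeEdges_of_ball hc hL.ge g1.le hz (by omega) (by omega)
      hq hω
    exact hω.exists_mem_chainEnds hc (by omega) hf hcl
  have hsame : X.SameView o k x y := by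
    have key : ∀ z, X.dist o z ≤ k → X.dist x z + X.dist y a = X.dist y z + X.dist x a :=
      fun z hz => hc.dist_add_of_gate haW hxy (hgate x ⟨hadj, by omega⟩ z hz)
        (hgate y ⟨hadj, by omega⟩ z hz)
    intro z hz
    have h1 := key z hz
    have h2 := key o (by simp)
    omega
  have h1 := hx y hsame
  have h2 := hZ1 y hy v (Sym2.mem_mk_right _ _)
  have h3 := hc.dist_triangle (u := o) (v := v) (w := y)
  omega

/-- The number of views from a ball about `o` onto a ball about `o₁` is bounded if the distance of
the balls is large. -/
theorem IsEdgeCofinite.exists_encard_image_ball_le {δ : ℕ} (hG : X.IsEdgeCofinite G)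
    (h : X.IsPreservedBy G) (hc : X.Connected) (hf : X.IsUniformlyFine)
    (hT : X.HasThinTriangles δ) :
    ∃ A C : ℕ, ∀ (o o₁ : V) (k r : ℕ) (ρ : V → V),
      (∀ x y, X.SameView o k x y → ρ x = ρ y) → k + r + C ≤ X.dist o o₁ →
      (ρ '' {x | X.dist o₁ x ≤ r}).encard ≤ A := by
  set L := 16 * δ + 4 with hL
  obtain ⟨A, hA⟩ := hG.exists_finset_dist_add h hc hf L 1
  refine ⟨A, 7 * δ + 3, fun o o₁ k r ρ hρ hd => ?_⟩
  obtain ⟨γ, hγ⟩ := hc.exists_geodesic o o₁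
  have hlen : γ.length = X.dist o o₁ := hγ
  -- The edge at this height is too far from the ball about `o` for a `4 * δ` error, and `7 * δ + 3`
  -- leaves its far end more than `r + 3 * δ` from `o₁`. Every geodesic between the two balls
  -- therefore has an edge close to it.
  set i := k + 4 * δ + 1 with hi
  obtain ⟨g3, g4⟩ := hγ.dist_getVert_right hc (i := i) (by omega)
  obtain ⟨g5, g6⟩ := hγ.dist_getVert_right hc (i := i + 1) (by omega)
  have hadj := γ.adj_getVert_succ (i := i) (by omega)
  set u := γ.getVert i
  set v := γ.getVert (i + 1)
  obtain ⟨Z, hZ, -, hZ2⟩ := hA s(u, v) hadj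
  choose τ hτ1 hτ2 using hZ2
  have huW : u ∈ X.chainEnds L 1 s(u, v) :=
    ⟨_, (CloseEdges.refl _ _).chain.mono (by omega), Sym2.mem_mk_left _ _⟩
  have hgate : ∀ x, X.dist o₁ x ≤ r → ∀ z, X.dist o z ≤ k →
      ∃ w ∈ X.chainEnds L 1 s(u, v), X.dist x w + X.dist w z = X.dist x z := by
    intro x hx z hz
    obtain ⟨ω, hω⟩ := hc.exists_geodesic z x
    obtain ⟨f, hf, hcl⟩ := hc.exists_closeEdges_of_fellow (L := L) (η := 2 * δ) (by omega)
      (p := o) (q := o₁) hadj (by omega) hω (by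
        intro a ha ha'
        have t1 := hc.dist_triangle (u := o₁) (v := a) (w := u)
        have t2 := hc.dist_triangle (u := o₁) (v := a) (w := v)
        have t3 := hc.dist_triangle (u := o) (v := a) (w := u)
        have t4 := hc.dist_triangle (u := o) (v := a) (w := v)
        have c1 := X.dist_comm (u := u) (v := a)
        have c2 := X.dist_comm (u := v) (v := a)
        have c3 := X.dist_comm (u := u) (v := o₁)
        have c4 := X.dist_comm (u := v) (v := o₁)
        rcases hT.exists_between hc x ha with ⟨b, hb, hab⟩ | ⟨b, hb, hab⟩
        · exfalso
          have t5 := hc.dist_triangle (u := o₁) (v := b) (w := a)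
          have c5 := X.dist_comm (u := b) (v := a)
          omega
        · have c6 := X.dist_comm (u := x) (v := b)
          have c7 := X.dist_comm (u := b) (v := o)
          have c8 := X.dist_comm (u := x) (v := o)
          rcases hT.exists_right hc (x := x) (y := o) (a := b) hω.reverse (by omega) with
            ⟨m, hm, hbm⟩ | ⟨m, hm, hbm⟩
          · have t5 := hc.dist_triangle (u := a) (v := b) (w := m)
            exact ⟨m, by simpa using hm, by omega⟩
          · exfalso
            have t5 := hc.dist_triangle (u := o) (v := b) (w := a)
            have t6 := hc.dist_triangle (u := o) (v := m) (w := b)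
            have c5 := X.dist_comm (u := b) (v := a)
            have c9 := X.dist_comm (u := m) (v := b)
            omega)
      (Or.inl (by omega)) (Or.inl (by omega))
    exact hω.exists_mem_chainEnds hc le_rfl hf hcl
  have hsame : ∀ x x', X.dist o₁ x ≤ r → X.dist o₁ x' ≤ r → τ x = τ x' →
      X.SameView o k x x' := by
    intro x x' hx hx' hxx'
    have hW : ∀ w ∈ X.chainEnds L 1 s(u, v), ∀ w' ∈ X.chainEnds L 1 s(u, v),
        X.dist x w + X.dist x' w' = X.dist x w' + X.dist x' w := by
      intro w hw w' hw'
      have h1 := hτ2 x w hw w' hw'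
      have h2 := hτ2 x' w hw w' hw'
      rw [hxx'] at h1
      omega
    have key : ∀ z, X.dist o z ≤ k → X.dist x z + X.dist x' u = X.dist x' z + X.dist x u :=
      fun z hz => hc.dist_add_of_gate huW hW (hgate x hx z hz) (hgate x' hx' z hz)
    intro z hz
    have h1 := key z hz
    have h2 := key o (by simp)
    omega
  classical
  let σ : V → V := fun y =>
    if hy : ∃ x, X.dist o₁ x ≤ r ∧ τ x = y then ρ hy.choose else y
  have hsub : ρ '' {x | X.dist o₁ x ≤ r} ⊆ (Z.image σ : Finset V) := by
    rintro _ ⟨x, hx, rfl⟩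
    have hx' : X.dist o₁ x ≤ r := hx
    have hex : ∃ x', X.dist o₁ x' ≤ r ∧ τ x' = τ x := ⟨x, hx', rfl⟩
    rw [Finset.mem_coe, Finset.mem_image]
    refine ⟨τ x, hτ1 x, ?_⟩
    simp only [σ, dif_pos hex]
    exact hρ _ _ (hsame _ _ hex.choose_spec.1 hx' hex.choose_spec.2)
  refine (Set.encard_le_encard hsub).trans ?_
  rw [Set.encard_coe_eq_coe_finsetCard]
  exact_mod_cast Finset.card_image_le.trans hZ

end Action

end SimpleGraph

/-! ### Square summable families and sparse matrices -/

/-- The Hilbert space of square summable families. -/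
abbrev SqSum (Y : Type*) : Type _ := lp (fun _ : Y => ℂ) 2

namespace SqSum

variable {Y : Type*}

lemma sum_norm_sq_le (v : SqSum Y) (s : Finset Y) : ∑ y ∈ s, ‖v y‖ ^ 2 ≤ ‖v‖ ^ 2 := by
  simpa using lp.sum_rpow_le_norm_rpow (p := 2) (by norm_num) v s

lemma norm_apply_le (v : SqSum Y) (y : Y) : ‖v y‖ ≤ ‖v‖ :=
  lp.norm_apply_le_norm (by norm_num) v y

lemma ext_clm [DecidableEq Y] {F : Type*} [AddCommGroup F] [Module ℂ F] [TopologicalSpace F]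
    [T2Space F] {T S : SqSum Y →L[ℂ] F}
    (h : ∀ y, T (lp.single 2 y (1 : ℂ)) = S (lp.single 2 y (1 : ℂ))) : T = S := by
  refine lp.ext_continuousLinearMap (ENNReal.ofNat_ne_top (n := nat_lit 2)) fun y => ?_
  ext
  exact h y

/-- Schur's test for sparse matrices. -/
theorem exists_clm_of_sparse [DecidableEq Y] (col : Y → SqSum Y) {b : ℝ} {N : ℕ} (hb₀ : 0 ≤ b)
    (hb : ∀ y z, ‖col y z‖ ≤ b) (hcol : ∀ y, {z | col y z ≠ 0}.encard ≤ N)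
    (hrow : ∀ z, {y | col y z ≠ 0}.encard ≤ N) :
    ∃ T : SqSum Y →L[ℂ] SqSum Y, ‖T‖ ≤ N * b ∧
      (∀ v z (s : Finset Y), {y | col y z ≠ 0} ⊆ s → T v z = ∑ y ∈ s, v y * col y z) ∧
      ∀ y, T (lp.single 2 y (1 : ℂ)) = col y := by
  classical
  have hfin := fun z => Set.finite_of_encard_le_coe (hrow z)
  set r : Y → Finset Y := fun z => (hfin z).toFinset with hr
  have hmem : ∀ y z, y ∈ r z ↔ col y z ≠ 0 := fun y z => by simp [hr]
  have hrN : ∀ z, (r z).card ≤ N := fun z => by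
    have := hrow z
    rw [(hfin z).encard_eq_coe_toFinset_card] at this
    change ((r z).card : ℕ∞) ≤ N at this
    exact_mod_cast this
  have hcN : ∀ (s : Finset Y) y, (s.filter fun z => y ∈ r z).card ≤ N := fun s y => by
    have h1 : ((s.filter fun z => y ∈ r z : Finset Y) : Set Y) ⊆ {z | col y z ≠ 0} := by
      intro z hz
      exact (hmem y z).1 (Finset.mem_filter.1 hz).2
    have := (Set.encard_le_encard h1).trans (hcol y)
    rw [Set.encard_coe_eq_coe_finsetCard] at this
    exact_mod_cast this
  have key : ∀ (v : SqSum Y) (s : Finset Y),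
      ∑ z ∈ s, ‖∑ y ∈ r z, v y * col y z‖ ^ 2 ≤ (N * b * ‖v‖) ^ 2 := by
    intro v s
    have h1 : ∀ z ∈ s, ‖∑ y ∈ r z, v y * col y z‖ ^ 2 ≤ N * b ^ 2 * ∑ y ∈ r z, ‖v y‖ ^ 2 := by
      intro z _
      have h2 : ‖∑ y ∈ r z, v y * col y z‖ ≤ b * ∑ y ∈ r z, ‖v y‖ := by
        refine (norm_sum_le _ _).trans ?_
        rw [Finset.mul_sum]
        refine Finset.sum_le_sum fun y _ => ?_
        rw [norm_mul, mul_comm]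
        exact mul_le_mul_of_nonneg_right (hb y z) (norm_nonneg _)
      have h3 := sq_sum_le_card_mul_sum_sq (s := r z) (f := fun y => ‖v y‖)
      have h4 : ((r z).card : ℝ) ≤ N := by exact_mod_cast hrN z
      have h5 : 0 ≤ ∑ y ∈ r z, ‖v y‖ ^ 2 := Finset.sum_nonneg fun _ _ => by positivity
      calc ‖∑ y ∈ r z, v y * col y z‖ ^ 2 ≤ (b * ∑ y ∈ r z, ‖v y‖) ^ 2 := by gcongr
        _ = b ^ 2 * (∑ y ∈ r z, ‖v y‖) ^ 2 := by ring
        _ ≤ b ^ 2 * (N * ∑ y ∈ r z, ‖v y‖ ^ 2) := by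
          gcongr
          exact h3.trans (by gcongr)
        _ = _ := by ring
    have h6 : ∑ z ∈ s, ∑ y ∈ r z, ‖v y‖ ^ 2 ≤ N * ‖v‖ ^ 2 := by
      rw [Finset.sum_comm' (t' := s.biUnion r) (s' := fun y => s.filter fun z => y ∈ r z)]
      · calc ∑ y ∈ s.biUnion r, ∑ _z ∈ s.filter (fun z => y ∈ r z), ‖v y‖ ^ 2
            ≤ ∑ y ∈ s.biUnion r, N * ‖v y‖ ^ 2 := by
              refine Finset.sum_le_sum fun y _ => ?_
              rw [Finset.sum_const, nsmul_eq_mul]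
              have : ((s.filter fun z => y ∈ r z).card : ℝ) ≤ N := by exact_mod_cast hcN s y
              gcongr
          _ ≤ N * ‖v‖ ^ 2 := by
              rw [← Finset.mul_sum]
              gcongr
              exact sum_norm_sq_le v _
      · intro z y
        simp only [Finset.mem_filter, Finset.mem_biUnion]
        exact ⟨fun h => ⟨⟨h.1, h.2⟩, z, h.1, h.2⟩, fun h => h.1⟩
    calc ∑ z ∈ s, ‖∑ y ∈ r z, v y * col y z‖ ^ 2
        ≤ ∑ z ∈ s, N * b ^ 2 * ∑ y ∈ r z, ‖v y‖ ^ 2 := Finset.sum_le_sum h1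
      _ = N * b ^ 2 * ∑ z ∈ s, ∑ y ∈ r z, ‖v y‖ ^ 2 := by rw [Finset.mul_sum]
      _ ≤ N * b ^ 2 * (N * ‖v‖ ^ 2) := by gcongr
      _ = _ := by ring
  let T₀ : SqSum Y →ₗ[ℂ] SqSum Y :=
    { toFun := fun v => ⟨fun z => ∑ y ∈ r z, v y * col y z,
        memℓp_gen' (C := (N * b * ‖v‖) ^ 2) fun s => by simpa using key v s⟩
      map_add' := fun v v' => by
        ext z
        simp only [lp.coeFn_add, Pi.add_apply, add_mul, Finset.sum_add_distrib]
      map_smul' := fun a v => by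
        ext z
        simp [Finset.mul_sum, mul_assoc] }
  have hT₀ : ∀ v z, T₀ v z = ∑ y ∈ r z, v y * col y z := fun _ _ => rfl
  have hsum : ∀ v z (s : Finset Y), {y | col y z ≠ 0} ⊆ s → T₀ v z = ∑ y ∈ s, v y * col y z := by
    intro v z s hs
    rw [hT₀]
    refine Finset.sum_subset (fun y hy => hs ((hmem y z).1 hy)) fun y _ hy => ?_
    rw [hmem, not_not] at hy
    rw [hy, mul_zero]
  refine ⟨T₀.mkContinuous (N * b) fun v => ?_, T₀.mkContinuous_norm_le (by positivity) _,
    hsum, fun y => ?_⟩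
  · refine lp.norm_le_of_forall_sum_le (p := 2) (by norm_num) (by positivity) fun s => ?_
    simpa [hT₀] using key v s
  · ext z
    have := hsum (lp.single 2 y (1 : ℂ)) z (insert y (r z))
      (fun y' hy' => Finset.mem_coe.2 (Finset.mem_insert_of_mem ((hmem y' z).2 hy')))
    refine this.trans ?_
    rw [Finset.sum_eq_single y]
    · simp
    · intro y' _ hne
      simp [hne]
    · simp

/-- Up to isometry, the space of square summable families only depends on the cardinality of the
index type. -/
lemma exists_linearIsometryEquiv {Y : Type*} {Z : Type*} (e : Z ≃ Y) :
    Nonempty (SqSum Y ≃ₗᵢ[ℂ] SqSum Z) := by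
  let b : HilbertBasis Y ℂ (SqSum Y) := ⟨LinearIsometryEquiv.refl ℂ _⟩
  have h1 : Orthonormal ℂ (b ∘ e) := b.orthonormal.comp e e.injective
  refine ⟨(HilbertBasis.mk h1 ?_).repr⟩
  rw [Set.range_comp, e.surjective.range_eq, Set.image_univ]
  exact b.dense_span.ge

end SqSum

/-! ### The obstruction to strong Property (T) -/

/-- The representations of a group which are used to disprove strong Property (T): there is a
nonzero invariant functional which vanishes on all invariant vectors. -/
def HasUnsplitInvariants {G : Type u} [Group G] (l : G → ℝ) (t : ℝ) (E : Type v)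
    [NormedAddCommGroup E] [InnerProductSpace ℂ E] : Prop :=
  ∃ (π : G →* (E →L[ℂ] E)) (f : E →L[ℂ] ℂ), f ≠ 0 ∧
    (∃ L : ℝ, 0 ≤ L ∧ ∀ g, ‖π g‖ ≤ L * Real.exp (t * l g)) ∧
    (∀ g v, f (π g v) = f v) ∧ ∀ v, (∀ g, π g v = v) → f v = 0

lemma HasUnsplitInvariants.map {G : Type u} [Group G] {l : G → ℝ} {t : ℝ} {E : Type v}
    [NormedAddCommGroup E] [InnerProductSpace ℂ E] {F : Type w} [NormedAddCommGroup F]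
    [InnerProductSpace ℂ F] (h : HasUnsplitInvariants l t E) (e : E ≃ₗᵢ[ℂ] F) :
    HasUnsplitInvariants l t F := by
  obtain ⟨π, f, hf, ⟨L, hL, hπ⟩, h1, h2⟩ := h
  let E₁ : E →L[ℂ] F := e.toContinuousLinearEquiv
  let E₂ : F →L[ℂ] E := e.symm.toContinuousLinearEquiv
  have h12 : ∀ x, E₂ (E₁ x) = x := e.symm_apply_apply
  have h21 : ∀ x, E₁ (E₂ x) = x := e.apply_symm_apply
  have hE₁ : ∀ x, ‖E₁ x‖ = ‖x‖ := e.norm_map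
  have hE₂ : ∀ x, ‖E₂ x‖ = ‖x‖ := e.symm.norm_map
  refine ⟨{ toFun := fun g => E₁ ∘L π g ∘L E₂, map_one' := ?_, map_mul' := ?_ }, f ∘L E₂, ?_,
    ⟨L, hL, fun g => ?_⟩, ?_, ?_⟩
  · ext x
    simp [h21]
  · intro g g'
    ext x
    simp [h12]
  · intro h0
    refine hf ?_
    ext x
    simpa [h12] using congrArg (fun q : F →L[ℂ] ℂ => q (E₁ x)) h0
  · refine ContinuousLinearMap.opNorm_le_bound _ (by positivity) fun x => ?_
    change ‖E₁ (π g (E₂ x))‖ ≤ _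
    rw [hE₁]
    refine ((π g).le_opNorm _).trans ?_
    rw [hE₂]
    exact mul_le_mul_of_nonneg_right (hπ g) (norm_nonneg _)
  · intro g x
    simp [h12, h1]
  · intro x hx
    refine h2 (E₂ x) fun g => ?_
    have := congrArg E₂ (hx g)
    simpa [h12] using this

lemma map_repMeasure_apply {G : Type u} [Group G] {E : Type v} [NormedAddCommGroup E]
    [InnerProductSpace ℂ E] (π : G →* (E →L[ℂ] E)) (f : E →L[ℂ] ℂ)
    (h : ∀ g v, f (π g v) = f v) (m : G →₀ ℝ) (x : E) :
    f (repMeasure π m x) = (m.sum fun _ a => (a : ℂ)) * f x := by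
  simp [repMeasure, Finsupp.sum, h, Finset.sum_mul]

/-- The limits of `f (π(m_n) x)` and of `f` on the trivial representation coincide, but they are 0
and `f x`. As `t` is only provided after `E`, one space `E` has to serve for all `t`. -/
theorem not_hasStrongPropertyT {G : Type u} [Group G] (l : LengthFunction G) {E : Type v}
    [NormedAddCommGroup E] [InnerProductSpace ℂ E] [CompleteSpace E]
    (h : ∀ t : ℝ, 0 < t → HasUnsplitInvariants l.toFun t E) : ¬ HasStrongPropertyT.{u, v} G := by
  intro hT
  obtain ⟨m, -, hm⟩ := hT l
  obtain ⟨t, ht, hπ⟩ := hm E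
  obtain ⟨π, f, hf, hL, h1, h2⟩ := h t ht
  obtain ⟨P, hP, hP'⟩ := hπ π hL
  obtain ⟨P₀, hP₀, hP₀'⟩ := hπ 1 ⟨1, zero_le_one, fun g => by
    have h3 : 0 ≤ t * l.toFun g := mul_nonneg ht.le (l.nonneg g)
    rw [one_mul]
    exact ContinuousLinearMap.norm_id_le.trans (Real.one_le_exp h3)⟩
  obtain ⟨x, hx⟩ : ∃ x, f x ≠ 0 := by
    by_contra! h0
    exact hf (by ext x; simpa using h0 x)
  have h0 : P₀ x = x := by
    have : x ∈ Set.range P₀ := by rw [hP₀.2]; intro g; rfl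
    obtain ⟨y, rfl⟩ := this
    exact congrArg (fun T : E →L[ℂ] E => T y) hP₀.1
  have h4 : f (P x) = 0 := h2 _ (by
    have : P x ∈ Set.range P := ⟨x, rfl⟩
    rwa [hP.2] at this)
  have hcont : Continuous fun T : E →L[ℂ] E => f (T x) :=
    f.continuous.comp (ContinuousLinearMap.apply ℂ E x).continuous
  have l1 := (hcont.tendsto P).comp hP'
  have l2 := (hcont.tendsto P₀).comp hP₀'
  have heq : ((fun T : E →L[ℂ] E => f (T x)) ∘ fun n => repMeasure π (m n)) =
      (fun T : E →L[ℂ] E => f (T x)) ∘ fun n => repMeasure 1 (m n) := by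
    funext n
    simp only [Function.comp]
    rw [map_repMeasure_apply π f h1, map_repMeasure_apply 1 f fun _ _ => rfl]
  rw [heq] at l1
  have h5 := tendsto_nhds_unique l1 l2
  rw [h4, h0] at h5
  exact hx h5.symm

/-- A sequence of natural numbers of subexponential growth. -/
def IsSubexponential (N : ℕ → ℕ) : Prop :=
  ∀ ε : ℝ, 0 < ε → ∃ L : ℝ, 0 ≤ L ∧ ∀ d : ℕ, (N d : ℝ) ≤ L * Real.exp (ε * d)

lemma isSubexponential_sq (A B : ℕ) : IsSubexponential fun d => A * (d + B) ^ 2 := by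
  intro ε hε
  refine ⟨A * (2 / ε ^ 2 * Real.exp (ε * B)), by positivity, fun d => ?_⟩
  have h1 := Real.pow_div_factorial_le_exp (ε * (d + B)) (by positivity) 2
  have h2 : Real.exp (ε * B) * Real.exp (ε * d) = Real.exp (ε * (d + B)) := by
    rw [← Real.exp_add]; ring_nf
  rw [mul_assoc, mul_assoc, h2]
  push_cast
  have h3 : ((d : ℝ) + B) ^ 2 = 2 / ε ^ 2 * ((ε * (d + B)) ^ 2 / (2).factorial) := by
    rw [Nat.factorial_two]
    field_simp
    norm_num
  rw [h3]
  gcongr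

namespace SimpleGraph

/-! ### Projections to nearest vertices and sparsity of their differences -/

section Projections

variable {V : Type*} {X : SimpleGraph V} {o : V} {ρ : ℕ → V → V}

/-- A choice of a nearest vertex in each class of vertices looking alike from the ball of
radius `k` about `o`. -/
structure IsProjectionSystem (X : SimpleGraph V) (o : V) (ρ : ℕ → V → V) : Prop where
  congr : ∀ {k x y}, X.SameView o k x y → ρ k x = ρ k y
  same : ∀ k x, X.SameView o k x (ρ k x)
  nearest : ∀ k x, X.IsNearest o k (ρ k x)

lemma exists_isProjectionSystem (X : SimpleGraph V) (o : V) : ∃ ρ, X.IsProjectionSystem o ρ := by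
  let S : ℕ → Setoid V := fun k => ⟨X.SameView o k, ⟨SameView.refl o k, SameView.symm,
    SameView.trans⟩⟩
  have key : ∀ (k : ℕ) (q : Quotient (S k)), ∃ y, Quotient.mk (S k) y = q ∧
      ∀ z, Quotient.mk (S k) z = q → X.dist o y ≤ X.dist o z := by
    intro k q
    have hne : {y | Quotient.mk (S k) y = q}.Nonempty := q.exists_rep
    obtain ⟨y, hy, hy'⟩ := exists_minimalFor_of_wellFoundedLT
      (fun y => y ∈ {y | Quotient.mk (S k) y = q}) (X.dist o) hne
    refine ⟨y, hy, fun z hz => ?_⟩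
    rcases le_total (X.dist o y) (X.dist o z) with h | h
    · exact h
    · exact hy' hz h
  choose σ h1 h2 using key
  refine ⟨fun k x => σ k (Quotient.mk (S k) x), ⟨?_, ?_, ?_⟩⟩
  · intro k x y hxy
    exact congrArg (σ k) (Quotient.sound hxy)
  · intro k x
    exact (Quotient.exact (h1 k (Quotient.mk (S k) x))).symm
  · intro k x y hy
    refine h2 k _ y ?_
    rw [← h1 k (Quotient.mk (S k) x)]
    exact (Quotient.sound hy).symm

namespace IsProjectionSystem

lemma proj_proj (hρ : X.IsProjectionSystem o ρ) {j k : ℕ} (hjk : j ≤ k) (x : V) :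
    ρ j (ρ k x) = ρ j x :=
  (hρ.congr ((hρ.same k x).mono hjk)).symm

lemma proj_zero (hρ : X.IsProjectionSystem o ρ) (hc : X.Connected) (x : V) : ρ 0 x = o := by
  have h1 := hρ.nearest 0 x o (sameView_zero hc _ _ _)
  rw [SimpleGraph.dist_self, Nat.le_zero, hc.dist_eq_zero_iff] at h1
  exact h1.symm

lemma le_dist_proj (hρ : X.IsProjectionSystem o ρ) (hc : X.Connected) {k : ℕ} {x : V}
    (hx : k ≤ X.dist o x) : k ≤ X.dist o (ρ k x) := by
  by_contra! hlt
  rw [(hρ.same k x).symm.eq_of_dist_lt hc hlt] at hlt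
  omega

lemma proj_dist (hρ : X.IsProjectionSystem o ρ) (hc : X.Connected) (x : V) :
    ρ (X.dist o x) x = x := by
  have h1 := (hρ.same (X.dist o x) x).dist_eq le_rfl
  have h2 := hρ.nearest (X.dist o x) x x (hρ.same _ _).symm
  exact (hc.dist_eq_zero_iff.1 (by omega)).symm

end IsProjectionSystem

/-- The nodes: projections with their radius. -/
def IsNode (X : SimpleGraph V) (o : V) (ρ : ℕ → V → V) (y : ℕ × V) : Prop :=
  ρ y.1 y.2 = y.2 ∧ y.1 ≤ X.dist o y.2

lemma IsProjectionSystem.isNode (hρ : X.IsProjectionSystem o ρ) (hc : X.Connected) {k : ℕ} {x : V}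
    (hk : k ≤ X.dist o x) : X.IsNode o ρ (k, ρ k x) :=
  ⟨hρ.proj_proj le_rfl x, hρ.le_dist_proj hc hk⟩

open Classical in
/-- The indicator function of the nodes which are projections of `x`. -/
noncomputable def nodeInd (X : SimpleGraph V) (o : V) (ρ : ℕ → V → V) (x : V) (z : ℕ × V) : ℂ :=
  if z.1 ≤ X.dist o x ∧ ρ z.1 x = z.2 then 1 else 0

open Classical in
/-- The change of the indicator function of projections along the step of a node. -/
noncomputable def nodeDiff (X : SimpleGraph V) (o : V) (ρ : ℕ → V → V) {G : Type*} [Group G]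
    [MulAction G V] (g : G) (y z : ℕ × V) : ℂ :=
  if X.IsNode o ρ y then
    X.nodeInd o ρ (g • y.2) z - if y.1 = 0 then 0 else X.nodeInd o ρ (g • ρ (y.1 - 1) y.2) z
  else 0

variable {G : Type*} [Group G] [MulAction G V]

lemma norm_nodeDiff_le (g : G) (y z : ℕ × V) : ‖X.nodeDiff o ρ g y z‖ ≤ 1 := by
  unfold nodeDiff nodeInd
  split_ifs <;> simp

/-- For positive `k` a nonzero entry means that exactly one of `g • u` and `g • ρ (k - 1) u`
projects to `c` at radius `R`; translation by `g⁻¹` gives a split pair. The condition on the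
distance from `o` causes no extra case: a vertex strictly inside the ball is determined by its view.
-/
lemma nodeDiff_ne_zero (h : X.IsPreservedBy G) (hc : X.Connected)
    (hρ : X.IsProjectionSystem o ρ) {g : G} {k R : ℕ} {u c : V}
    (hne : X.nodeDiff o ρ g (k, u) (R, c) ≠ 0) :
    (k = 0 ∧ u = o ∧ R ≤ X.dist o (g • o) ∧ c = ρ R (g • o)) ∨
      ∃ p, X.SplitPair o (g⁻¹ • o) k R (g⁻¹ • c) u (ρ (k - 1) u) p ∧ c = ρ R (g • p) := by
  unfold nodeDiff at hne
  split_ifs at hne with hnode hk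
  · left
    obtain rfl : k = 0 := hk
    have hu : ρ 0 u = u := hnode.1
    obtain rfl : u = o := by rw [← hu]; exact hρ.proj_zero hc _
    unfold nodeInd at hne
    split_ifs at hne with h1
    · exact ⟨rfl, rfl, h1.1, h1.2.symm⟩
    · simp at hne
  · right
    have hk' : 1 ≤ k := Nat.one_le_iff_ne_zero.2 hk
    have hdist : ∀ x, X.dist (g⁻¹ • o) x = X.dist o (g • x) := fun x => by
      rw [← h.dist_smul hc g]; simp
    have hview : ∀ {x y}, X.SameView (g⁻¹ • o) R x y ↔ X.SameView o R (g • x) (g • y) :=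
      fun {x y} => by rw [← h.sameView_smul_iff hc g]; simp
    have hview' : ∀ {x}, X.SameView (g⁻¹ • o) R x (g⁻¹ • c) ↔ X.SameView o R (g • x) c :=
      fun {x} => by rw [hview]; simp
    have hsame : X.SameView o (k - 1) u (ρ (k - 1) u) := hρ.same _ _
    have hnear : X.IsNearest o k u := by
      have hu : ρ k u = u := hnode.1
      rw [← hu]
      exact hρ.nearest _ _
    have key : ∀ x y, (R ≤ X.dist o (g • x) ∧ ρ R (g • x) = c) →
        ¬ (R ≤ X.dist o (g • y) ∧ ρ R (g • y) = c) → ¬ X.SameView (g⁻¹ • o) R x y := by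
      intro x y hx hy hxy
      have h1 : ρ R (g • y) = c := by rw [← hρ.congr (hview.1 hxy), hx.2]
      have h2 : X.dist (g⁻¹ • o) y < R := by
        rw [hdist]
        by_contra! h3
        exact hy ⟨h3, h1⟩
      have h3 := hxy.symm.eq_of_dist_lt hc h2
      rw [h3] at hy
      exact hy hx
    by_cases h1 : R ≤ X.dist o (g • u) ∧ ρ R (g • u) = c
    · by_cases h2 : R ≤ X.dist o (g • ρ (k - 1) u) ∧ ρ R (g • ρ (k - 1) u) = c
      · simp [nodeInd, h1, h2] at hne
      · refine ⟨u, ⟨hk', hnode.2, hnear, hρ.nearest _ _, hsame, key _ _ h1 h2, Or.inl rfl, ?_, ?_⟩,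
          h1.2.symm⟩
        · rw [hview', ← h1.2]
          exact hρ.same _ _
        · rw [hdist]
          exact h1.1
    · by_cases h2 : R ≤ X.dist o (g • ρ (k - 1) u) ∧ ρ R (g • ρ (k - 1) u) = c
      · refine ⟨ρ (k - 1) u, ⟨hk', hnode.2, hnear, hρ.nearest _ _, hsame,
          fun h3 => key _ _ h2 h1 h3.symm, Or.inr rfl, ?_, ?_⟩, h2.2.symm⟩
        · rw [hview', ← h2.2]
          exact hρ.same _ _
        · rw [hdist]
          exact h2.1
      · simp [nodeInd, h1, h2] at hne
  · simp at hne

/-- Otherwise the ball about `o₁` is contained in the ball of radius `k - 1` about `o`, from which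
`x` and `y` look alike. -/
lemma SplitPair.le_add (hc : X.Connected) {o o₁ c x y p : V} {k R : ℕ}
    (h : X.SplitPair o o₁ k R c x y p) : k ≤ R + X.dist o o₁ := by
  by_contra! hlt
  exact h.not_same (h.same.of_dist_add_le hc (by omega))

lemma SplitPair.le_add' (hc : X.Connected) {C : ℕ}
    (hC : ∀ (o : V) (k : ℕ) (x : V), X.IsNearest o k x → X.dist o x ≤ k + C) {o o₁ c x y p : V}
    {k R : ℕ} (h : X.SplitPair o o₁ k R c x y p) : R ≤ k + X.dist o o₁ + C := by
  have h1 := hC o k x h.nearest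
  have h2 := hC o (k - 1) y h.nearest'
  have h3 := h.le_dist_p
  have h4 := hc.dist_triangle (u := o₁) (v := o) (w := p)
  have h5 := X.dist_comm (u := o₁) (v := o)
  rcases h.eq_or with rfl | rfl <;> omega

/-- The matrices of differences of projections are sparse. -/
theorem IsUniformlyFine.exists_nodeDiff_sparse {δ C : ℕ} (hf : X.IsUniformlyFine)
    (h : X.IsPreservedBy G) (hc : X.Connected) (hT : X.HasThinTriangles δ)
    (hC : ∀ (o : V) (k : ℕ) (x : V), X.IsNearest o k x → X.dist o x ≤ k + C) :
    ∃ N : ℕ → ℕ, IsSubexponential N ∧ ∀ (o : V) (ρ : ℕ → V → V),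
      X.IsProjectionSystem o ρ → ∀ g : G,
        (∀ y z, X.nodeDiff o ρ g y z ≠ 0 → z.1 ≤ y.1 + X.dist o (g • o) + C) ∧
        (∀ y, {z | X.nodeDiff o ρ g y z ≠ 0}.encard ≤ N (X.dist o (g • o))) ∧
        ∀ z, {y | X.nodeDiff o ρ g y z ≠ 0}.encard ≤ N (X.dist o (g • o)) := by
  classical
  obtain ⟨A, hA⟩ := hf.exists_encard_splitPair_le hT hc C
  refine ⟨fun d => (2 * A + 4) * (d + (C + 1)) ^ 2, isSubexponential_sq _ _, ?_⟩
  intro o ρ hρ g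
  set d := X.dist o (g • o) with hd
  have hd' : X.dist o (g⁻¹ • o) = d := by
    rw [← h.dist_smul hc g, smul_inv_smul, X.dist_comm]
  have hlow : ∀ y z, X.nodeDiff o ρ g y z ≠ 0 → y.1 ≤ z.1 + d := by
    rintro ⟨k, u⟩ ⟨R, c⟩ hne
    rcases nodeDiff_ne_zero h hc hρ hne with ⟨rfl, -⟩ | ⟨p, hp, -⟩
    · simp
    · simpa [hd'] using hp.le_add hc
  have hup : ∀ y z, X.nodeDiff o ρ g y z ≠ 0 → z.1 ≤ y.1 + d + C := by
    rintro ⟨k, u⟩ ⟨R, c⟩ hne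
    rcases nodeDiff_ne_zero h hc hρ hne with ⟨rfl, -, h1, -⟩ | ⟨p, hp, -⟩
    · simp only
      omega
    · simpa [hd'] using hp.le_add' hc hC
  refine ⟨hup, ?_, ?_⟩
  · rintro ⟨k, u⟩
    -- In a column the radius `R` is confined to an interval and leaves at most two choices of `c`.
    have hsub : {z | X.nodeDiff o ρ g (k, u) z ≠ 0} ⊆
        (((Finset.Icc (k - d) (k + d + C)).image fun R => (R, ρ R (g • u))) ∪
          ((Finset.Icc (k - d) (k + d + C)).image fun R => (R, ρ R (g • ρ (k - 1) u))) :
            Finset (ℕ × V)) := by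
      rintro ⟨R, c⟩ hne
      have h1 := hlow _ _ hne
      have h2 := hup _ _ hne
      have h3 : R ∈ Finset.Icc (k - d) (k + d + C) := by
        simp only at h1 h2
        rw [Finset.mem_Icc]
        omega
      rw [Finset.mem_coe, Finset.mem_union]
      rcases nodeDiff_ne_zero h hc hρ hne with ⟨-, rfl, -, rfl⟩ | ⟨p, hp, rfl⟩
      · exact Or.inl (Finset.mem_image.2 ⟨R, h3, rfl⟩)
      · rcases hp.eq_or with rfl | rfl
        · exact Or.inl (Finset.mem_image.2 ⟨R, h3, rfl⟩)
        · exact Or.inr (Finset.mem_image.2 ⟨R, h3, rfl⟩)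
    refine (Set.encard_le_encard hsub).trans ?_
    rw [Set.encard_coe_eq_coe_finsetCard]
    norm_cast
    refine (Finset.card_union_le _ _).trans ((add_le_add Finset.card_image_le
      Finset.card_image_le).trans ?_)
    rw [Nat.card_Icc]
    have h1 : k + d + C + 1 - (k - d) ≤ 2 * (d + (C + 1)) := by omega
    nlinarith [Nat.zero_le (A * (d + (C + 1)) ^ 2), Nat.zero_le d, Nat.zero_le C]
  · rintro ⟨R, c⟩
    -- In a row the radius `k` is confined to an interval, and the split pairs are counted for each
    -- `k`. Both factors are linear in `d`, hence the square.
    have hsub : {y | X.nodeDiff o ρ g y (R, c) ≠ 0} ⊆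
        insert (0, o) (⋃ k ∈ Finset.Icc (R - d - C) (R + d), Prod.mk k ''
          {x | X.dist o x ≤ k + C ∧ ∃ y p, X.SplitPair o (g⁻¹ • o) k R (g⁻¹ • c) x y p}) := by
      rintro ⟨k, u⟩ hne
      have h1 := hlow _ _ hne
      have h2 := hup _ _ hne
      simp only at h1 h2
      rcases nodeDiff_ne_zero h hc hρ hne with ⟨rfl, rfl, -, -⟩ | ⟨p, hp, -⟩
      · exact Set.mem_insert _ _
      · refine Set.mem_insert_of_mem _ (Set.mem_biUnion (x := k) ?_ ⟨u, ⟨?_, _, p, hp⟩, rfl⟩)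
        · rw [Finset.mem_coe, Finset.mem_Icc]
          omega
        · exact hC _ _ _ hp.nearest
    refine (Set.encard_le_encard hsub).trans ((Set.encard_insert_le _ _).trans ?_)
    have h1 : (⋃ k ∈ Finset.Icc (R - d - C) (R + d), Prod.mk k ''
          {x | X.dist o x ≤ k + C ∧ ∃ y p,
            X.SplitPair o (g⁻¹ • o) k R (g⁻¹ • c) x y p}).encard ≤
        ∑ k ∈ Finset.Icc (R - d - C) (R + d), ((A * (d + 1) : ℕ) : ℕ∞) := by
      refine (Finset.set_encard_biUnion_le _ _).trans (Finset.sum_le_sum fun k _ => ?_)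
      rw [(Prod.mk_right_injective k).encard_image]
      simpa [hd'] using hA o (g⁻¹ • o) k R (g⁻¹ • c)
    refine (add_le_add_left h1 1).trans ?_
    rw [Finset.sum_const, nsmul_eq_mul, Nat.card_Icc]
    norm_cast
    have h2 : R + d + 1 - (R - d - C) ≤ 2 * (d + (C + 1)) := by omega
    have h3 : A * (d + 1) ≤ A * (d + (C + 1)) := Nat.mul_le_mul_left _ (by omega)
    have h4 := Nat.mul_le_mul h2 h3
    have h5 : 1 ≤ (d + (C + 1)) ^ 2 := Nat.one_le_pow _ _ (by omega)
    nlinarith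

end Projections

end SimpleGraph

/-- The evaluation of square summable families at an index. -/
noncomputable def SqSum.eval {Y : Type*} (y : Y) : SqSum Y →L[ℂ] ℂ :=
  LinearMap.mkContinuous
    { toFun := fun v => v y, map_add' := fun _ _ => rfl, map_smul' := fun _ _ => rfl } 1
    fun v => by
      rw [one_mul]
      exact v.norm_apply_le y

@[simp] lemma SqSum.eval_apply {Y : Type*} (y : Y) (v : SqSum Y) : SqSum.eval y v = v y := rfl

namespace SimpleGraph

/-! ### Potentials and transfer operators -/

section Transfer

variable {V : Type*} {X : SimpleGraph V} {o : V} {ρ : ℕ → V → V}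

open Classical in
/-- The weighted sum of the projections of a vertex. -/
noncomputable def potential (X : SimpleGraph V) (o : V) (ρ : ℕ → V → V) (s : ℝ) (x : V) :
    SqSum (ℕ × V) :=
  ∑ k ∈ Finset.range (X.dist o x + 1),
    (Real.exp (s * k / 2) : ℂ) • lp.single 2 (k, ρ k x) (1 : ℂ)

lemma potential_apply (s : ℝ) (x : V) (z : ℕ × V) :
    X.potential o ρ s x z = Real.exp (s * z.1 / 2) * X.nodeInd o ρ x z := by
  classical
  unfold potential nodeInd
  rw [lp.coeFn_sum, Finset.sum_apply]
  simp only [lp.coeFn_smul, Pi.smul_apply, lp.single_apply, smul_eq_mul]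
  obtain ⟨R, c⟩ := z
  by_cases hR : R ≤ X.dist o x
  · rw [Finset.sum_eq_single R]
    · by_cases hρ : ρ R x = c
      · subst hρ
        simp [hR]
      · have h1 : (R, c) ≠ (R, ρ R x) := fun h => hρ (congrArg Prod.snd h).symm
        rw [Pi.single_eq_of_ne h1]
        simp [hρ]
    · intro k _ hk
      have h1 : (R, c) ≠ (k, ρ k x) := fun h => hk (congrArg Prod.fst h).symm
      rw [Pi.single_eq_of_ne h1, mul_zero]
    · intro h
      simp only [Finset.mem_range] at h
      omega
  · rw [Finset.sum_eq_zero]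
    · simp [hR]
    · intro k hk
      have h1 : (R, c) ≠ (k, ρ k x) := fun h => by
        have h2 : R = k := congrArg Prod.fst h
        have h3 := Finset.mem_range.1 hk
        omega
      rw [Pi.single_eq_of_ne h1, mul_zero]

variable {G : Type*} [Group G] [MulAction G V]

open Classical in
/-- The image of a basis vector under the operator which maps the potential of every vertex `x`
to the one of `g • x`. -/
noncomputable def transferVector (X : SimpleGraph V) (o : V) (ρ : ℕ → V → V) (s : ℝ) (g : G)
    (y : ℕ × V) : SqSum (ℕ × V) :=
  if X.IsNode o ρ y then
    (Real.exp (-(s * y.1 / 2)) : ℂ) • (X.potential o ρ s (g • y.2) -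
      if y.1 = 0 then 0 else X.potential o ρ s (g • ρ (y.1 - 1) y.2))
  else 0

lemma transferVector_apply (s : ℝ) (g : G) (y z : ℕ × V) :
    X.transferVector o ρ s g y z =
      Real.exp (s * z.1 / 2) * Real.exp (-(s * y.1 / 2)) * X.nodeDiff o ρ g y z := by
  unfold transferVector nodeDiff
  split_ifs
  · rw [lp.coeFn_smul, Pi.smul_apply, sub_zero, sub_zero, potential_apply, smul_eq_mul]
    ring
  · rw [lp.coeFn_smul, Pi.smul_apply, lp.coeFn_sub, Pi.sub_apply, potential_apply,
      potential_apply, smul_eq_mul]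
    ring
  · simp

/-- The operators with the given transfer vectors. -/
def IsTransfer (X : SimpleGraph V) (o : V) (ρ : ℕ → V → V) (s : ℝ)
    (T : G → SqSum (ℕ × V) →L[ℂ] SqSum (ℕ × V)) : Prop :=
  (∀ g v z (t : Finset (ℕ × V)), {y | X.nodeDiff o ρ g y z ≠ 0} ⊆ t →
    T g v z = ∑ y ∈ t, v y * X.transferVector o ρ s g y z) ∧
  open Classical in ∀ g y, T g (lp.single 2 y (1 : ℂ)) = X.transferVector o ρ s g y

/-- The level bound limits the entries by `exp (s * (d + C) / 2)` with `d = d(o, g • o)`. This uses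
half of the exponent `s`; the subexponential number of entries is absorbed by the other half. -/
lemma exists_isTransfer {C : ℕ} {N : ℕ → ℕ}
    (hN : IsSubexponential N) (h : ∀ g : G,
        (∀ y z, X.nodeDiff o ρ g y z ≠ 0 → z.1 ≤ y.1 + X.dist o (g • o) + C) ∧
        (∀ y, {z | X.nodeDiff o ρ g y z ≠ 0}.encard ≤ N (X.dist o (g • o))) ∧
        ∀ z, {y | X.nodeDiff o ρ g y z ≠ 0}.encard ≤ N (X.dist o (g • o))) {s : ℝ} (hs : 0 < s) :
    ∃ T : G → SqSum (ℕ × V) →L[ℂ] SqSum (ℕ × V), X.IsTransfer o ρ s T ∧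
      ∃ L : ℝ, 0 ≤ L ∧ ∀ g, ‖T g‖ ≤ L * Real.exp (s * X.dist o (g • o)) := by
  classical
  have hne : ∀ g : G, ∀ y z, X.transferVector o ρ s g y z ≠ 0 ↔ X.nodeDiff o ρ g y z ≠ 0 := by
    intro g y z
    rw [transferVector_apply]
    simp
  have hle : ∀ (g : G) y z, ‖X.transferVector o ρ s g y z‖ ≤
      Real.exp (s * (X.dist o (g • o) + C) / 2) := by
    intro g y z
    by_cases h0 : X.nodeDiff o ρ g y z = 0
    · rw [transferVector_apply, h0, mul_zero, norm_zero]
      positivity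
    · have h1 := (h g).1 y z h0
      have h2 : (z.1 : ℝ) ≤ y.1 + X.dist o (g • o) + C := by exact_mod_cast h1
      rw [transferVector_apply, ← Complex.ofReal_mul, ← Real.exp_add, norm_mul,
        Complex.norm_real, Real.norm_of_nonneg (Real.exp_nonneg _)]
      calc Real.exp (s * z.1 / 2 + -(s * y.1 / 2)) * ‖X.nodeDiff o ρ g y z‖
          ≤ Real.exp (s * z.1 / 2 + -(s * y.1 / 2)) * 1 := by
            gcongr
            exact norm_nodeDiff_le g y z
        _ ≤ _ := by
            rw [mul_one, Real.exp_le_exp]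
            nlinarith
  have hex := fun g : G => SqSum.exists_clm_of_sparse (X.transferVector o ρ s g)
    (Real.exp_nonneg _) (hle g) (by simpa only [hne] using (h g).2.1)
    (by simpa only [hne] using (h g).2.2)
  choose T h1 h2 h3 using hex
  obtain ⟨L, hL, hNL⟩ := hN (s / 2) (by positivity)
  refine ⟨T, ⟨fun g v z t ht => h2 g v z t (by simpa only [hne] using ht), ?_⟩,
    L * Real.exp (s * C / 2), by positivity, fun g => (h1 g).trans ?_⟩
  · intro g y
    convert h3 g y
  · calc (N (X.dist o (g • o)) : ℝ) * Real.exp (s * (X.dist o (g • o) + C) / 2)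
        ≤ L * Real.exp (s / 2 * X.dist o (g • o)) *
            Real.exp (s * (X.dist o (g • o) + C) / 2) := by
          gcongr
          exact hNL _
      _ = L * Real.exp (s * C / 2) * Real.exp (s * X.dist o (g • o)) := by
          rw [mul_assoc, mul_assoc, ← Real.exp_add, ← Real.exp_add]
          ring_nf

/-- The weights cancel and the sum over the projections of `x` telescopes, because `ρ n (ρ (n + 1)
x) = ρ n x`. It ends with `x` itself, which is its own projection at radius `d(o, x)`. -/
lemma IsTransfer.apply_potential {s : ℝ} {T : G → SqSum (ℕ × V) →L[ℂ] SqSum (ℕ × V)}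
    (hT : X.IsTransfer o ρ s T) (hρ : X.IsProjectionSystem o ρ) (hc : X.Connected) (g : G)
    (x : V) : T g (X.potential o ρ s x) = X.potential o ρ s (g • x) := by
  classical
  have key : ∀ n ≤ X.dist o x, ∑ k ∈ Finset.range (n + 1),
      (Real.exp (s * k / 2) : ℂ) • X.transferVector o ρ s g (k, ρ k x) =
        X.potential o ρ s (g • ρ n x) := by
    intro n
    induction n with
    | zero =>
      intro _
      simp [transferVector, hρ.isNode hc (Nat.zero_le (X.dist o x))]
    | succ n ih =>
      intro hn
      rw [Finset.sum_range_succ, ih (by omega), transferVector, if_pos (hρ.isNode hc hn),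
        smul_smul, ← Complex.ofReal_mul, ← Real.exp_add, add_neg_cancel, Real.exp_zero]
      simp [hρ.proj_proj (Nat.le_succ n)]
  rw [potential, map_sum]
  simp only [map_smul, hT.2]
  rw [key _ le_rfl, hρ.proj_dist hc]

lemma IsTransfer.mul {s : ℝ} {T : G → SqSum (ℕ × V) →L[ℂ] SqSum (ℕ × V)}
    (hT : X.IsTransfer o ρ s T) (hρ : X.IsProjectionSystem o ρ) (hc : X.Connected) (g g' : G) :
    T g * T g' = T (g * g') := by
  classical
  refine SqSum.ext_clm fun y => ?_
  rw [mul_apply_eq_comp, hT.2, hT.2]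
  unfold transferVector
  split_ifs <;> simp [hT.apply_potential hρ hc, mul_smul]

/-- All potentials have coordinate 1 at `(0, o)`, so their differences vanish there; only the single
node of radius 0 contributes. -/
lemma IsTransfer.apply_origin {s : ℝ} {T : G → SqSum (ℕ × V) →L[ℂ] SqSum (ℕ × V)}
    (hT : X.IsTransfer o ρ s T) (hρ : X.IsProjectionSystem o ρ) (hc : X.Connected) (g : G)
    (v : SqSum (ℕ × V)) : T g v (0, o) = v (0, o) := by
  classical
  have h1 : ∀ y, X.nodeDiff o ρ g y (0, o) = if y = (0, o) then 1 else 0 := by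
    rintro ⟨k, u⟩
    unfold nodeDiff nodeInd IsNode
    simp only [hρ.proj_zero hc, Nat.zero_le, and_self, if_true, Prod.mk.injEq]
    by_cases hk : k = 0
    · subst hk
      by_cases hu : u = o
      · simp [hu, hρ.proj_zero hc]
      · simp [hu, hρ.proj_zero hc, Ne.symm hu]
    · simp [hk]
  rw [hT.1 g v (0, o) {(0, o)} (by intro y; simp [h1])]
  simp [transferVector_apply, h1]

end Transfer

end SimpleGraph

namespace SimpleGraph

/-! ### Invariant vectors vanish at the origin -/

section Invariants

variable {V : Type*} {X : SimpleGraph V} {o : V} {ρ : ℕ → V → V}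
variable {G : Type*} [Group G] [MulAction G V]

open Classical in
lemma sum_nodeInd (D : Finset V) (k : ℕ) (x : V) :
    ∑ u ∈ D, X.nodeInd o ρ x (k, u) = if k ≤ X.dist o x ∧ ρ k x ∈ D then 1 else 0 := by
  unfold nodeInd
  by_cases hk : k ≤ X.dist o x <;> simp [hk]

open Classical in
lemma sum_nodeDiff (D : Finset V) (k : ℕ) (g : G) {y : ℕ × V} (hy : X.IsNode o ρ y) :
    ∑ u ∈ D, X.nodeDiff o ρ g y (k, u) =
      (if k ≤ X.dist o (g • y.2) ∧ ρ k (g • y.2) ∈ D then 1 else 0) -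
        if y.1 = 0 then 0 else
          if k ≤ X.dist o (g • ρ (y.1 - 1) y.2) ∧ ρ k (g • ρ (y.1 - 1) y.2) ∈ D then 1 else 0 := by
  unfold nodeDiff
  simp only [if_pos hy, Finset.sum_sub_distrib, sum_nodeInd]
  split_ifs <;> simp [sum_nodeInd, *]

lemma norm_sum_nodeDiff_le (D : Finset V) (k : ℕ) (g : G) (y : ℕ × V) :
    ‖∑ u ∈ D, X.nodeDiff o ρ g y (k, u)‖ ≤ 1 := by
  by_cases hy : X.IsNode o ρ y
  · rw [sum_nodeDiff D k g hy]
    split_ifs <;> simp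
  · simp [nodeDiff, hy]

/-- Test `T g v = v` against the weighted sum of the coordinates at radius `k` in the projections
`D` of the ball about `g • o`. On the left the coordinate `v (0, o)` enters with coefficient 1 and
nodes of low radius cancel, as both of their vertices are carried into the ball. The remaining
coefficients, and the weight on the right, are exponentially small. -/
lemma IsTransfer.norm_origin_le {s : ℝ} (hs : 0 < s)
    {T : G → SqSum (ℕ × V) →L[ℂ] SqSum (ℕ × V)}
    (hT : X.IsTransfer o ρ s T) (hρ : X.IsProjectionSystem o ρ) (h : X.IsPreservedBy G)
    (hc : X.Connected) {C n A k r : ℕ} {g : G}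
    (hC : ∀ (o : V) (k : ℕ) (x : V), X.IsNearest o k x → X.dist o x ≤ k + C)
    (hn : ∀ z, {y | X.nodeDiff o ρ g y z ≠ 0}.encard ≤ n)
    (hA : (ρ k '' {x | X.dist (g • o) x ≤ r}).encard ≤ A) (hd : k + r ≤ X.dist o (g • o))
    {v : SqSum (ℕ × V)} (hv : T g v = v) :
    ‖v (0, o)‖ ≤ (A * Real.exp (-(s * k / 2)) + A * n * Real.exp (-(s * (r - C) / 2))) * ‖v‖ := by
  classical
  have hDfin := Set.finite_of_encard_le_coe hA
  have hrfin := fun z => Set.finite_of_encard_le_coe (hn z)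
  obtain ⟨D, hD⟩ : ∃ D : Finset V, ∀ u, u ∈ D ↔ ∃ x, X.dist (g • o) x ≤ r ∧ ρ k x = u :=
    ⟨hDfin.toFinset, fun u => by simp⟩
  have hDA : (D.card : ℝ) ≤ A := by
    have h1 : (D : Set V) = ρ k '' {x | X.dist (g • o) x ≤ r} := by
      ext u
      simp [hD]
    rw [← h1, Set.encard_coe_eq_coe_finsetCard] at hA
    exact_mod_cast hA
  obtain ⟨row, hrow⟩ : ∃ row : ℕ × V → Finset (ℕ × V), ∀ z y, y ∈ row z ↔
      X.nodeDiff o ρ g y z ≠ 0 := ⟨fun z => (hrfin z).toFinset, fun z y => by simp⟩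
  have hrown : ∀ z, (row z).card ≤ n := fun z => by
    have h1 : (row z : Set (ℕ × V)) = {y | X.nodeDiff o ρ g y z ≠ 0} := by
      ext y
      simp [hrow]
    have h2 := hn z
    rw [← h1, Set.encard_coe_eq_coe_finsetCard] at h2
    exact_mod_cast h2
  set U := D.biUnion fun u => row (k, u) with hU
  have hUcard : (U.card : ℝ) ≤ A * n := by
    have h1 : U.card ≤ D.card * n := Finset.card_biUnion_le_card_mul _ _ _ fun u _ => hrown _
    calc (U.card : ℝ) ≤ D.card * n := by exact_mod_cast h1
      _ ≤ A * n := by gcongr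
  set E := Real.exp (-(s * k / 2)) with hE
  -- These are the coefficients of the test functional composed with `T g`; the factor `E` removes
  -- the weight of radius `k`.
  set κ : ℕ × V → ℂ := fun y => ∑ u ∈ D, (E : ℂ) * X.transferVector o ρ s g y (k, u) with hκ
  have hκ' : ∀ y, κ y = Real.exp (-(s * y.1 / 2)) * ∑ u ∈ D, X.nodeDiff o ρ g y (k, u) := by
    intro y
    rw [hκ, Finset.mul_sum]
    refine Finset.sum_congr rfl fun u _ => ?_
    rw [transferVector_apply, ← mul_assoc, ← mul_assoc, hE, ← Complex.ofReal_mul, ← Real.exp_add,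
      neg_add_cancel, Real.exp_zero, Complex.ofReal_one, one_mul]
  have hball : ∀ x, X.dist o x ≤ r → k ≤ X.dist o (g • x) ∧ ρ k (g • x) ∈ D := by
    intro x hx
    have h1 : X.dist (g • o) (g • x) ≤ r := by rwa [h.dist_smul hc]
    have h2 := hc.dist_triangle (u := o) (v := g • x) (w := g • o)
    have h3 := X.dist_comm (u := g • o) (v := g • x)
    exact ⟨by omega, (hD _).2 ⟨_, h1, rfl⟩⟩
  have hκ0 : κ (0, o) = 1 := by
    have hnode : X.IsNode o ρ (0, o) := ⟨hρ.proj_zero hc _, by simp⟩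
    rw [hκ', sum_nodeDiff D k g hnode, if_pos (hball o (by simp))]
    simp
  have hκle : ∀ y, y ≠ (0, o) → ‖κ y‖ ≤ Real.exp (-(s * (r - C) / 2)) := by
    rintro ⟨R, u⟩ hy
    rw [hκ']
    by_cases hnode : X.IsNode o ρ (R, u)
    · have hu : ρ R u = u := hnode.1
      have hR : R ≠ 0 := by
        rintro rfl
        rw [hρ.proj_zero hc] at hu
        exact hy (by rw [← hu])
      by_cases hRr : R + C ≤ r
      · have h1 := hC o R (ρ R u) (hρ.nearest _ _)
        have h2 := hC o (R - 1) (ρ (R - 1) u) (hρ.nearest _ _)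
        rw [hu] at h1
        rw [sum_nodeDiff D k g hnode, if_neg hR, if_pos (hball u (by omega)),
          if_pos (hball (ρ (R - 1) u) (by omega)), sub_self, mul_zero, norm_zero]
        positivity
      · rw [norm_mul, Complex.norm_real, Real.norm_of_nonneg (Real.exp_nonneg _)]
        calc Real.exp (-(s * R / 2)) * ‖∑ u' ∈ D, X.nodeDiff o ρ g (R, u) (k, u')‖
            ≤ Real.exp (-(s * R / 2)) * 1 := by
              gcongr
              exact norm_sum_nodeDiff_le _ _ _ _
          _ ≤ _ := by
              rw [mul_one, Real.exp_le_exp]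
              have h3 : (r : ℝ) ≤ R + C := by
                have : r ≤ R + C := by omega
                exact_mod_cast this
              nlinarith
    · have h1 : ∀ z, X.nodeDiff o ρ g (R, u) z = 0 := fun z => by simp [nodeDiff, hnode]
      simp only [h1, Finset.sum_const_zero, mul_zero, norm_zero]
      positivity
  have hsum : ∑ u ∈ D, (E : ℂ) * v (k, u) = v (0, o) + ∑ y ∈ U.erase (0, o), v y * κ y := by
    have h1 : ∀ u ∈ D, (E : ℂ) * v (k, u) =
        ∑ y ∈ insert (0, o) U, v y * (E * X.transferVector o ρ s g y (k, u)) := by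
      intro u hu
      have h2 := hT.1 g v (k, u) (insert (0, o) U) (by
        intro y hy
        exact Finset.mem_coe.2 (Finset.mem_insert_of_mem
          (Finset.mem_biUnion.2 ⟨u, hu, (hrow _ _).2 hy⟩)))
      rw [hv] at h2
      rw [h2, Finset.mul_sum]
      exact Finset.sum_congr rfl fun y _ => by ring
    rw [Finset.sum_congr rfl h1, Finset.sum_comm]
    have h4 : ∀ y, ∑ u ∈ D, v y * (E * X.transferVector o ρ s g y (k, u)) = v y * κ y :=
      fun y => by rw [hκ, Finset.mul_sum]
    simp only [h4]
    have h3 : insert (0, o) U = insert (0, o) (U.erase (0, o)) := by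
      ext y
      simp only [Finset.mem_insert, Finset.mem_erase]
      tauto
    rw [h3, Finset.sum_insert (Finset.notMem_erase _ _)]
    rw [hκ0, mul_one]
  have h1 : v (0, o) = ∑ u ∈ D, (E : ℂ) * v (k, u) - ∑ y ∈ U.erase (0, o), v y * κ y := by
    rw [hsum]
    ring
  have h2 : ‖∑ u ∈ D, (E : ℂ) * v (k, u)‖ ≤ A * E * ‖v‖ := by
    calc ‖∑ u ∈ D, (E : ℂ) * v (k, u)‖ ≤ ∑ _u ∈ D, E * ‖v‖ := by
          refine (norm_sum_le _ _).trans (Finset.sum_le_sum fun u _ => ?_)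
          rw [norm_mul, Complex.norm_real, Real.norm_of_nonneg (Real.exp_nonneg _)]
          gcongr
          exact v.norm_apply_le _
      _ = D.card * (E * ‖v‖) := by rw [Finset.sum_const, nsmul_eq_mul]
      _ ≤ A * (E * ‖v‖) := by gcongr
      _ = _ := by ring
  have h3 : ‖∑ y ∈ U.erase (0, o), v y * κ y‖ ≤ A * n * Real.exp (-(s * (r - C) / 2)) * ‖v‖ := by
    calc ‖∑ y ∈ U.erase (0, o), v y * κ y‖
        ≤ ∑ _y ∈ U.erase (0, o), ‖v‖ * Real.exp (-(s * (r - C) / 2)) := by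
          refine (norm_sum_le _ _).trans (Finset.sum_le_sum fun y hy => ?_)
          rw [norm_mul]
          exact mul_le_mul (v.norm_apply_le _) (hκle y (Finset.ne_of_mem_erase hy))
            (norm_nonneg _) (norm_nonneg _)
      _ = (U.erase (0, o)).card * (‖v‖ * Real.exp (-(s * (r - C) / 2))) := by
          rw [Finset.sum_const, nsmul_eq_mul]
      _ ≤ U.card * (‖v‖ * Real.exp (-(s * (r - C) / 2))) := by
          gcongr
          exact Finset.erase_subset _ _
      _ ≤ A * n * (‖v‖ * Real.exp (-(s * (r - C) / 2))) := by gcongr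
      _ = _ := by ring
  rw [h1]
  refine (norm_sub_le _ _).trans ((add_le_add h2 h3).trans (le_of_eq ?_))
  ring

/-- A group with unbounded orbits which acts cofinitely on the edges of a hyperbolic uniformly fine
graph has invariant functionals of arbitrarily small exponential growth which do not split off. -/
theorem IsEdgeCofinite.hasUnsplitInvariants {δ : ℕ} (hG : X.IsEdgeCofinite G)
    (h : X.IsPreservedBy G) (hc : X.Connected) (hf : X.IsUniformlyFine)
    (hT : X.HasThinTriangles δ) (o : V) (hunb : ∀ n, ∃ g : G, n ≤ X.dist o (g • o)) {s : ℝ}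
    (hs : 0 < s) :
    HasUnsplitInvariants (fun g : G => (X.dist o (g • o) : ℝ)) s (SqSum (ℕ × V)) := by
  classical
  obtain ⟨C, hC⟩ := hG.exists_dist_le_of_isNearest h hc hf hT
  obtain ⟨N, hN, hsparse⟩ := hf.exists_nodeDiff_sparse h hc hT hC
  obtain ⟨A, C', hA⟩ := hG.exists_encard_image_ball_le h hc hf hT
  obtain ⟨ρ, hρ⟩ := X.exists_isProjectionSystem o
  obtain ⟨T, hTr, L, hL, hTL⟩ := exists_isTransfer hN (hsparse o ρ hρ) hs
  have hmul := hTr.mul hρ hc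
  -- `T 1` is only an idempotent. The correction makes the group act trivially on its kernel.
  refine ⟨{ toFun := fun g => T g + 1 - T 1, map_one' := by simp, map_mul' := fun g g' => ?_ },
    SqSum.eval (0, o), ?_, ⟨L + 1 + ‖T 1‖, by positivity, fun g => ?_⟩, ?_, ?_⟩
  · simp only [sub_mul, mul_sub, add_mul, mul_add, hmul, mul_one, one_mul]
    abel
  · intro h0
    have h1 := congrArg (fun f : SqSum (ℕ × V) →L[ℂ] ℂ => f (lp.single 2 (0, o) (1 : ℂ))) h0
    simp at h1
  · have h1 : 1 ≤ Real.exp (s * X.dist o (g • o)) := Real.one_le_exp (by positivity)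
    calc ‖T g + 1 - T 1‖ ≤ ‖T g‖ + 1 + ‖T 1‖ := by
          refine (norm_sub_le _ _).trans (add_le_add_left ((norm_add_le _ _).trans ?_) _)
          exact add_le_add_right ContinuousLinearMap.norm_id_le _
      _ ≤ L * Real.exp (s * X.dist o (g • o)) + 1 * Real.exp (s * X.dist o (g • o)) +
          ‖T 1‖ * Real.exp (s * X.dist o (g • o)) := by
          refine add_le_add (add_le_add (hTL g) (by simpa using h1)) ?_
          exact le_mul_of_one_le_right (norm_nonneg _) h1
      _ = _ := by ring
  · intro g v
    change (T g v + v - T 1 v : SqSum (ℕ × V)) (0, o) = v (0, o)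
    simp [hTr.apply_origin hρ hc]
  · intro v hv
    set v' := T 1 v with hv'
    have hinv : ∀ g, T g v' = v' := by
      intro g
      have h1 : T g v + v - T 1 v = v := hv g
      have h2 : T g v = T 1 v := by
        rw [add_sub_right_comm, add_eq_right, sub_eq_zero] at h1
        exact h1
      have h3 : T g (T 1 v) = T g v := by
        have := congrArg (fun S : SqSum (ℕ × V) →L[ℂ] SqSum (ℕ × V) => S v) (hmul g 1)
        simpa using this
      rw [hv', h3, h2]
    have horig : v (0, o) = v' (0, o) := (hTr.apply_origin hρ hc 1 v).symm
    rw [SqSum.eval_apply, horig, ← norm_le_zero_iff]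
    -- With `d(o, g • o)` about `2 * k` the entries number at most a constant times `exp (s * k /
    -- 4)`, against the decay `exp (-(s * k / 2))`.
    obtain ⟨M, hM, hNM⟩ := hN (s / 8) (by positivity)
    set b : ℕ → ℝ := fun k => (A * Real.exp (-(s * k / 2)) +
      A * (M * Real.exp (s / 8 * (2 * k + C' + 1))) * Real.exp (-(s * (k - C) / 2))) * ‖v'‖ with hb
    have hexp : ∀ a : ℝ, 0 < a → Tendsto (fun k : ℕ => Real.exp (-(a * k))) atTop (𝓝 0) := by
      intro a ha
      refine Real.tendsto_exp_neg_atTop_nhds_zero.comp ?_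
      exact tendsto_natCast_atTop_atTop.const_mul_atTop ha
    have hlim : Tendsto b atTop (𝓝 0) := by
      have h1 := ((hexp (s / 2) (by positivity)).const_mul (A : ℝ)).add
        ((hexp (s / 4) (by positivity)).const_mul
          (A * M * Real.exp (s / 8 * (C' + 1) + s * C / 2)))
      have h2 := h1.mul_const ‖v'‖
      simp only [mul_zero, add_zero, zero_mul] at h2
      refine h2.congr fun k => ?_
      rw [hb]
      simp only
      congr 1
      congr 1
      · ring_nf
      · rw [mul_assoc (A * M : ℝ), ← Real.exp_add, ← mul_assoc (A : ℝ) M, mul_assoc (A * M : ℝ),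
          ← Real.exp_add]
        ring_nf
    refine ge_of_tendsto_of_frequently hlim (frequently_atTop.2 fun k₀ => ?_)
    obtain ⟨g, hg⟩ := hunb (2 * k₀ + C')
    set k := (X.dist o (g • o) - C') / 2 with hk
    refine ⟨k, by omega, ?_⟩
    have hd : k + k + C' ≤ X.dist o (g • o) := by omega
    have hd' : X.dist o (g • o) ≤ 2 * k + C' + 1 := by omega
    have h1 := hTr.norm_origin_le hs hρ h hc hC (hsparse o ρ hρ g).2.2
      (hA o (g • o) k k (ρ k) (fun _ _ => hρ.congr) hd) (by omega) (hinv g)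
    refine h1.trans ?_
    have h2 : (X.dist o (g • o) : ℝ) ≤ 2 * k + C' + 1 := by exact_mod_cast hd'
    have h3 : (N (X.dist o (g • o)) : ℝ) ≤ M * Real.exp (s / 8 * (2 * k + C' + 1)) :=
      (hNM _).trans (by gcongr)
    rw [hb]
    simp only
    gcongr

end Invariants

end SimpleGraph

/-! ### Unbounded orbits in the coned-off Cayley graph -/

namespace SimpleGraph

/-- A stabiliser element `f` of `c` turns the first edge towards `g • c` by a large angle. Then `c`
lies between `g • c` and `f • g • c`, so `g⁻¹ * f * g` moves `c` twice as far as `g`. -/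
lemma HasThinTriangles.exists_le_dist_smul {V : Type*} {X : SimpleGraph V} {G : Type*} [Group G]
    [MulAction G V] {δ L : ℕ} (hT : X.HasThinTriangles δ) (h : X.IsPreservedBy G)
    (hc : X.Connected) (hL : 8 * δ + 4 ≤ L) {c : V} (hmove : ∃ g : G, g • c ≠ c)
    (hstab : ∀ b, X.Adj c b → ∃ g : G, g • c = c ∧ ¬ X.CloseEdges L s(c, b) s(c, g • b)) (n : ℕ) :
    ∃ g : G, n ≤ X.dist c (g • c) := by
  induction n with
  | zero => exact ⟨1, Nat.zero_le _⟩
  | succ n ih =>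
    obtain ⟨g, hg, hpos⟩ : ∃ g : G, n ≤ X.dist c (g • c) ∧ 1 ≤ X.dist c (g • c) := by
      rcases Nat.eq_zero_or_pos n with rfl | hn
      · obtain ⟨g, hg⟩ := hmove
        exact ⟨g, Nat.zero_le _, hc.pos_dist_of_ne hg.symm⟩
      · obtain ⟨g, hg⟩ := ih
        exact ⟨g, hg, le_trans hn hg⟩
    have hne : c ≠ g • c := by
      intro h0
      rw [← h0, SimpleGraph.dist_self] at hpos
      omega
    obtain ⟨b, hb, hbd⟩ := hc.exists_adj_dist hne
    obtain ⟨f, hf, hfar⟩ := hstab b hb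
    have h1 := h f c b hb
    rw [hf] at h1
    have h2 : ∀ x, X.dist (f • x) (f • g • c) = X.dist x (g • c) := fun x => h.dist_smul hc f _ _
    have h3 := h2 c
    rw [hf] at h3
    have h4 : X.dist (g • c) c + X.dist c (f • g • c) = X.dist (g • c) (f • g • c) := by
      by_contra h0
      exact hfar (hT.closeEdges_of_dist_ne hc hL hb hbd h1 (by rw [h2, h3, hbd]) h0)
    refine ⟨g⁻¹ * f * g, ?_⟩
    rw [← h.dist_smul hc g, mul_smul, mul_smul, smul_inv_smul, ← h4, h3,
      X.dist_comm (u := g • c)]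
    omega

end SimpleGraph

section ConedOff

open SimpleGraph

variable {G : Type u} [Group G] {ι : Type w} {S : Finset G} {H : ι → Subgroup G}

lemma conedOffCayleyGraph_adj_inl {a b : G} :
    (conedOffCayleyGraph (S : Set G) H).Adj (.inl a) (.inl b) ↔
      a ≠ b ∧ ∃ s ∈ S, a * s = b ∨ a = b * s := by
  change (SimpleGraph.mulCayley (S : Set G)).Adj a b ↔ _
  rw [SimpleGraph.mulCayley_adj']
  rfl

lemma conedOffCayleyGraph_adj_inr {a : G} {c : Σ i, G ⧸ H i} :
    (conedOffCayleyGraph (S : Set G) H).Adj (.inr c) (.inl a) ↔ (a : G ⧸ H c.1) = c.2 := Iff.rfl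

lemma conedOffCayleyGraph_isPreservedBy (S : Finset G) (H : ι → Subgroup G) :
    (conedOffCayleyGraph (S : Set G) H).IsPreservedBy G := by
  rintro g (a | ⟨i, c⟩) (b | ⟨j, d⟩) hab
  · rw [conedOffCayleyGraph_adj_inl] at hab
    obtain ⟨hne, s, hs, h⟩ := hab
    rw [Sum.smul_inl, Sum.smul_inl, conedOffCayleyGraph_adj_inl]
    refine ⟨fun h0 => hne (mul_left_cancel h0), s, hs, ?_⟩
    rcases h with rfl | rfl
    · exact Or.inl (mul_assoc _ _ _)
    · exact Or.inr (mul_assoc _ _ _).symm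
  · obtain rfl : (a : G ⧸ H j) = d := hab
    rfl
  · obtain rfl : (b : G ⧸ H i) = c := hab
    rfl
  · exact hab.elim

lemma conedOffCayleyGraph_isEdgeCofinite [Finite ι] (S : Finset G) (H : ι → Subgroup G) :
    (conedOffCayleyGraph (S : Set G) H).IsEdgeCofinite G := by
  classical
  have := Fintype.ofFinite ι
  have hinr : ∀ (a : G) (i : ι), (s((.inl 1 : G ⊕ (Σ i, G ⧸ H i)),
      .inr ⟨i, ((1 : G) : G ⧸ H i)⟩)).map (a • ·) = s(.inl a, .inr ⟨i, (a : G ⧸ H i)⟩) := by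
    intro a i
    simp [Sum.smul_inl, Sum.smul_inr, Sigma.smul_mk]
  refine ⟨(S.image fun s => s(.inl 1, .inl s)) ∪
    (Finset.univ.image fun i => s(.inl 1, .inr ⟨i, ((1 : G) : G ⧸ H i)⟩)), fun e he => ?_⟩
  induction e using Sym2.ind with
  | _ x y =>
    rw [SimpleGraph.mem_edgeSet] at he
    rcases x with a | ⟨i, c⟩ <;> rcases y with b | ⟨j, d⟩
    · obtain ⟨-, s, hs, rfl | rfl⟩ := conedOffCayleyGraph_adj_inl.1 he
      · exact ⟨a, _, Finset.mem_union_left _ (Finset.mem_image_of_mem _ hs), by simp⟩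
      · exact ⟨b, _, Finset.mem_union_left _ (Finset.mem_image_of_mem _ hs),
          by simp [Sym2.eq_swap]⟩
    · obtain rfl : (a : G ⧸ H j) = d := he
      exact ⟨a, _, Finset.mem_union_right _ (Finset.mem_image_of_mem _ (Finset.mem_univ j)),
        hinr a j⟩
    · obtain rfl : (b : G ⧸ H i) = c := he
      exact ⟨b, _, Finset.mem_union_right _ (Finset.mem_image_of_mem _ (Finset.mem_univ i)),
        (hinr b i).trans Sym2.eq_swap⟩
    · exact he.elim

lemma conedOffCayleyGraph_finite_neighborSet [Finite ι] (hH : ∀ i, Finite (H i))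
    (x : G ⊕ (Σ i, G ⧸ H i)) :
    ((conedOffCayleyGraph (S : Set G) H).neighborSet x).Finite := by
  classical
  rcases x with a | ⟨i, c⟩
  · refine (((((S.image fun s => a * s) ∪ (S.image fun s => a * s⁻¹) : Finset G).finite_toSet).image
      (Sum.inl : G → G ⊕ (Σ i, G ⧸ H i))).union
      (Set.finite_range fun i => (.inr ⟨i, (a : G ⧸ H i)⟩ : G ⊕ (Σ i, G ⧸ H i)))).subset ?_
    rintro (b | ⟨j, d⟩) hb
    · obtain ⟨-, s, hs, rfl | rfl⟩ := (conedOffCayleyGraph_adj_inl (H := H)).1 hb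
      · exact Or.inl ⟨_, by simpa using Or.inl hs, rfl⟩
      · refine Or.inl ⟨b, ?_, rfl⟩
        rw [Finset.mem_coe, Finset.mem_union]
        exact Or.inr (Finset.mem_image.2 ⟨s, hs, by simp⟩)
    · obtain rfl : (a : G ⧸ H j) = d := hb
      exact Or.inr ⟨j, rfl⟩
  · obtain ⟨a, rfl⟩ := QuotientGroup.mk_surjective c
    have := hH i
    refine (Set.finite_range fun h : H i => (.inl (a * h) : G ⊕ (Σ i, G ⧸ H i))).subset ?_
    rintro (b | ⟨j, d⟩) hb
    · have h1 : (b : G ⧸ H i) = a := hb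
      exact ⟨⟨a⁻¹ * b, QuotientGroup.eq.1 h1.symm⟩, by simp⟩
    · exact hb.elim

lemma SimpleGraph.Connected.finite_ball {V : Type*} {X : SimpleGraph V} (hc : X.Connected)
    (hX : ∀ x, (X.neighborSet x).Finite) (o : V) (n : ℕ) : {x | X.dist o x ≤ n}.Finite := by
  induction n with
  | zero =>
    refine (Set.finite_singleton o).subset fun x hx => ?_
    have h1 : X.dist o x = 0 := Nat.le_zero.1 hx
    exact (hc.dist_eq_zero_iff.1 h1).symm
  | succ n ih =>
    refine ((Set.finite_singleton o).union (ih.biUnion fun y _ => hX y)).subset fun x hx => ?_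
    have hx' : X.dist o x ≤ n + 1 := hx
    by_cases h : x = o
    · exact Or.inl h
    · obtain ⟨a, h1, h2⟩ := hc.exists_adj_dist h
      refine Or.inr (Set.mem_biUnion (x := a) ?_ h1.symm)
      have c1 := X.dist_comm (u := o) (v := a)
      have c2 := X.dist_comm (u := o) (v := x)
      change X.dist o a ≤ n
      omega

theorem conedOffCayleyGraph_exists_le_dist [Infinite G] [Finite ι]
    (hH : ∀ i, Infinite (G ⧸ H i)) {δ : ℕ}
    (hc : (conedOffCayleyGraph (S : Set G) H).Connected)
    (hT : (conedOffCayleyGraph (S : Set G) H).HasThinTriangles δ)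
    (hf : (conedOffCayleyGraph (S : Set G) H).IsUniformlyFine) (n : ℕ) :
    ∃ g : G, n ≤ (conedOffCayleyGraph (S : Set G) H).dist (.inl 1) (g • .inl 1) := by
  set X := conedOffCayleyGraph (S : Set G) H with hX
  have h : X.IsPreservedBy G := conedOffCayleyGraph_isPreservedBy S H
  -- If all `H i` are finite, the graph is locally finite and the infinite orbit of 1 leaves every
  -- ball. Otherwise an infinite `H i` fixes its cone vertex, and by fineness only finitely many of
  -- its elements turn an edge there by a small angle; infinite index ensures that this vertex is
  -- moved at all.
  by_cases hfin : ∀ i, Finite (H i)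
  · by_contra! hlt
    refine Set.infinite_univ (α := G) (Set.Finite.of_finite_image (f := fun g : G =>
      g • (.inl 1 : G ⊕ (Σ i, G ⧸ H i)))
      ((hc.finite_ball (conedOffCayleyGraph_finite_neighborSet hfin) (.inl 1) n).subset ?_) ?_)
    · rintro _ ⟨g, -, rfl⟩
      exact (hlt g).le
    · intro g _ g' _ hgg'
      simpa [Sum.smul_inl] using hgg'
  · push Not at hfin
    obtain ⟨i, hi⟩ := hfin
    set c : G ⊕ (Σ i, G ⧸ H i) := .inr ⟨i, ((1 : G) : G ⧸ H i)⟩ with hcdef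
    obtain ⟨N, hN⟩ := hf.exists_encard_closeEdges_le (8 * δ + 4)
    have hadj : ∀ a : G, X.Adj c (.inl a) ↔ a ∈ H i := by
      intro a
      rw [hX, hcdef, conedOffCayleyGraph_adj_inr, eq_comm, QuotientGroup.eq]
      simp
    have hmove : ∃ g : G, g • c ≠ c := by
      have := hH i
      obtain ⟨q, hq⟩ := exists_ne ((1 : G) : G ⧸ H i)
      obtain ⟨g, rfl⟩ := QuotientGroup.mk_surjective q
      refine ⟨g, fun h0 => hq ?_⟩
      rw [hcdef, Sum.smul_inr, Sigma.smul_mk] at h0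
      simpa using h0
    have hstab : ∀ b, X.Adj c b → ∃ g : G, g • c = c ∧
        ¬ X.CloseEdges (8 * δ + 4) s(c, b) s(c, g • b) := by
      rintro (b | d) hb
      · by_contra! hcl
        have hfin := Set.finite_of_encard_le_coe (hN s(c, .inl b) hb)
        refine Set.infinite_univ (α := H i) (Set.Finite.of_finite_image
          (f := fun g : H i => s(c, (g : G) • (.inl b : G ⊕ (Σ i, G ⧸ H i)))) (hfin.subset ?_) ?_)
        · rintro _ ⟨g, -, rfl⟩
          refine hcl g ?_
          rw [hcdef, Sum.smul_inr, Sigma.smul_mk]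
          congr 2
          refine QuotientGroup.eq.2 ?_
          simp
        · intro g _ g' _ hgg'
          have h1 := Sym2.congr_right.1 hgg'
          simpa [Sum.smul_inl] using h1
      · exact hb.elim
    obtain ⟨g, hg⟩ := hT.exists_le_dist_smul h hc le_rfl hmove hstab (n + 2 * X.dist (.inl 1) c)
    refine ⟨g, ?_⟩
    have h1 := hc.dist_triangle (u := c) (v := .inl 1) (w := g • c)
    have h2 := hc.dist_triangle (u := .inl 1) (v := g • .inl 1) (w := g • c)
    rw [h.dist_smul hc] at h2
    have h3 := X.dist_comm (u := c) (v := .inl 1)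
    omega

end ConedOff

/-! ### Conclusion for relatively hyperbolic groups -/

theorem corollary1p3 {G : Type u} [Group G] [Infinite G] {ι : Type w} [Finite ι]
    (H : ι → Subgroup G) (hG : IsRelativelyHyperbolic H) (hH : ∀ i, Infinite (G ⧸ H i)) :
    ¬ HasStrongPropertyT.{u, v} G := by
  obtain ⟨S, hS, ⟨δ, -, hδ⟩, hf⟩ := hG
  set X := conedOffCayleyGraph (S : Set G) H with hX
  have hc : X.Connected := hδ.1
  have h : X.IsPreservedBy G := conedOffCayleyGraph_isPreservedBy S H
  have hcount : Countable G := by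
    have h1 : Function.Surjective (FreeGroup.lift ((↑) : S → G)) := by
      rw [← MonoidHom.range_eq_top, FreeGroup.range_lift_eq_closure, Subtype.range_coe]
      exact hS
    exact h1.countable
  have hcq : ∀ i, Countable (G ⧸ H i) := fun i => Quotient.countable
  -- The Hilbert space must lie in the universe of the definition, which is unrelated to that of
  -- `G`. Countability of the graph allows reindexing by a lifted copy of `ℕ`.
  obtain ⟨e⟩ : Nonempty (ULift.{v} ℕ ≃ ℕ × (G ⊕ (Σ i, G ⧸ H i))) := inferInstance
  obtain ⟨Φ⟩ := SqSum.exists_linearIsometryEquiv e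
  refine not_hasStrongPropertyT (E := SqSum (ULift.{v} ℕ))
    { toFun := fun g => X.dist (.inl 1) (g • .inl 1)
      nonneg := fun g => Nat.cast_nonneg _
      inv := fun g => ?_
      mul_le := fun g g' => ?_ } fun t ht => ?_
  · rw [← h.dist_smul hc g, smul_inv_smul, X.dist_comm]
  · have h1 := hc.dist_triangle (u := .inl 1) (v := g • .inl 1) (w := (g * g') • .inl 1)
    rw [mul_smul, h.dist_smul hc, ← mul_smul] at h1
    exact_mod_cast h1
  · exact ((conedOffCayleyGraph_isEdgeCofinite S H).hasUnsplitInvariants h hc hf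
      hδ.hasThinTriangles _ (conedOffCayleyGraph_exists_le_dist hH hc hδ.hasThinTriangles hf)
      ht).map Φ
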